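/- Let $(M,g)$ be a smooth four-dimensional Lorentzian manifold of signature $(3,1)$, time-oriented by a timelike vector field $T$, let $\varepsilon\in\{1,-1\}$, and let $(E_5,\eta)$ be the five-dimensional pseudo-Euclidean space of signature $(4,1)$ if $\varepsilon=1$ and $(3,2)$ if $\varepsilon=-1$. Let $U\subseteq M$ be a connected open set and $f:(U,g)\to(E_5,\eta)$ a smooth isometric embedding. Let $\tilde\nabla$ be the flat connection of $E_5$, $\nabla$ the Levi-Civita connection of $g$, $\Omega(X,Y)=\tilde\nabla_XY-\nabla_XY$ the normal-valued second fundamental form and $\vec H=g^{\alpha\beta}\Omega(\partial_\alpha,\partial_\beta)$ the mean curvature vector. For a unit normal $\xi$ (so that $\eta(\xi,\xi)=\varepsilon$) put $\Omega_{\alpha\beta}=\eta(\Omega(\partial_\alpha,\partial_\beta),\xi)$. Let $R=\sum_{\alpha<\beta}K(e_\alpha\wedge e_\beta)$ be the scalar curvature, the sum of the sectional curvatures over the coordinate planes of an orthonormal basis, and let $\Lambda(0)=\frac{2\cdot 4}{4-1}R=\frac83R$. The embedding is called causal-type preserving if, for every local smooth unit normal field $\xi$: when $\varepsilon=1$, $\tilde\nabla_X\xi$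 is tangent to $M$ and orthogonal to $T$ for every tangent vector $X\perp T$; when $\varepsilon=-1$, $\tilde\nabla_T\xi$ is a multiple of $T$. (In either case $\Omega(T,X)=0$ for all $X\perp T$.) (a) If $f$ is causal-type preserving on $U$ and ideal with $k=0$, i.e. $\eta(\vec H,\vec H)=\Lambda(0)$ at every point of $U$, then $f$ is umbilical: at every point of $U$ there are a unit normal $\xi$ and a number $\mu$ with $\Omega_{\alpha\beta}=\mu g_{\alpha\beta}$. (b) If $f$ is umbilical at every point of $U$, then there are a smooth unit normal field $\xi$ along $U$ and a constant $\mu$ such that $\Omega_{\alpha\beta}=\mu g_{\alpha\beta}$ on all of $U$. The metric $g$ has constant curvature $\varepsilon\mu^2$ on $U$: $$R_{\alpha\beta\gamma\delta}=\varepsilon\mu^2\,(g_{\alpha\gamma}g_{\delta\beta}-g_{\alpha\delta}g_{\gamma\beta}),\qquad R_{\alpha\beta\gamma\delta}=g(R(\partial_\gamma,\partial_\delta)\partial_\beta,\partial_\alpha).$$ If $\mu\neq0$, then $(U,g)$ is isometric to an open subset of the de Sitter space $\{y\in E_5:\eta(y,y)=1/\mu^2\}$ when $\varepsilon=1$, and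 to an open subset of the anti-de Sitter space $\{y\in E_5:\eta(y,y)=-1/\mu^2\}$ when $\varepsilon=-1$, each with the metric induced by $\eta$. (If $\mu=0$, then $g$ is flat on $U$.) -/

import Mathlib

open scoped Manifold ContDiff Topology
open Bundle

noncomputable section

namespace IdealEmbedding

/-- The model space of a four-dimensional manifold. -/
abbrev E4 := EuclideanSpace ℝ (Fin 4)

/-- The vector space underlying the five-dimensional pseudo-Euclidean spaces. -/
abbrev E5 := Fin 5 → ℝ

/-- The scalar product `η` of the five-dimensional pseudo-Euclidean space: it has signature
`(4,1)` for `ε = 1` and `(3,2)` for `ε = -1`. -/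
def eta (ε : ℝ) (x y : E5) : ℝ :=
  ε * (x 0 * y 0) + x 1 * y 1 + x 2 * y 2 + x 3 * y 3 - x 4 * y 4

/-- The standard basis vectors of the model space; the tangent space at `p` is identified with
the model space through the preferred chart at `p`, so these are also the coordinate vectors
`∂ᵢ` at `p`. -/
def e (i : Fin 4) : E4 := EuclideanSpace.single i (1 : ℝ)

/-- The partial derivative `∂ᵢ h` of a function of four real variables. -/
def pd {V : Type*} [NormedAddCommGroup V] [NormedSpace ℝ V] (i : Fin 4) (h : E4 → V) (x : E4) : V :=
  fderiv ℝ h x (e i)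

variable {M : Type*} [TopologicalSpace M] [ChartedSpace E4 M]

/-- A smooth Lorentzian metric, of signature `(3,1)`, on a four-dimensional manifold. -/
structure LorentzMetric (M : Type*) [TopologicalSpace M] [ChartedSpace E4 M]
    [IsManifold (𝓡 4) ∞ M] where
  val : ∀ p : M, TangentSpace (𝓡 4) p →L[ℝ] TangentSpace (𝓡 4) p →L[ℝ] ℝ
  symm : ∀ (p : M) (X Y : TangentSpace (𝓡 4) p), val p X Y = val p Y X
  signature : ∀ p : M, ∃ b : Module.Basis (Fin 4) ℝ (TangentSpace (𝓡 4) p),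
    ∀ i j, val p (b i) (b j) = if i = j then (if i = 3 then -1 else 1) else 0
  contMDiff : ContMDiff (𝓡 4) ((𝓡 4).prod 𝓘(ℝ, E4 →L[ℝ] E4 →L[ℝ] ℝ)) ∞
    (fun p ↦ TotalSpace.mk' (E4 →L[ℝ] E4 →L[ℝ] ℝ)
      (E := fun p : M ↦ TangentSpace (𝓡 4) p →L[ℝ] TangentSpace (𝓡 4) p →L[ℝ] ℝ) p (val p))

variable [IsManifold (𝓡 4) ∞ M]

/-- A continuous vector field that is everywhere timelike (a time orientation). -/
def IsTimelikeField (g : LorentzMetric M) (T : ∀ p : M, TangentSpace (𝓡 4) p) : Prop :=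
  Continuous (fun p ↦ (⟨p, T p⟩ : TangentBundle (𝓡 4) M)) ∧ ∀ p, g.val p (T p) (T p) < 0

/-! ### Intrinsic curvature, in the preferred chart at a point `p` -/

/-- The metric coefficients `gᵢⱼ(x)` in the chart at `p`. -/
def coordMetric (g : LorentzMetric M) (p : M) (x : E4) : Matrix (Fin 4) (Fin 4) ℝ :=
  Matrix.of fun i j ↦ g.val ((extChartAt (𝓡 4) p).symm x)
    (mfderiv 𝓘(ℝ, E4) (𝓡 4) (extChartAt (𝓡 4) p).symm x (e i))
    (mfderiv 𝓘(ℝ, E4) (𝓡 4) (extChartAt (𝓡 4) p).symm x (e j))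

/-- The Christoffel symbols `Γᵏᵢⱼ(x)` of the Levi-Civita connection in the chart at `p`. -/
def christoffel (g : LorentzMetric M) (p : M) (k i j : Fin 4) (x : E4) : ℝ :=
  (1 / 2) * ∑ l, (coordMetric g p x)⁻¹ k l *
    (pd i (fun y ↦ coordMetric g p y j l) x + pd j (fun y ↦ coordMetric g p y i l) x
      - pd l (fun y ↦ coordMetric g p y i j) x)

/-- The components `Rˡₖᵢⱼ(x)`, given by `R(∂ᵢ,∂ⱼ)∂ₖ = ∑ₗ Rˡₖᵢⱼ ∂ₗ` with
`R(X,Y)Z = ∇_X ∇_Y Z - ∇_Y ∇_X Z - ∇_[X,Y] Z`. -/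
def riemannUp (g : LorentzMetric M) (p : M) (l k i j : Fin 4) (x : E4) : ℝ :=
  pd i (christoffel g p l j k) x - pd j (christoffel g p l i k) x
    + ∑ m, (christoffel g p l i m x * christoffel g p m j k x
      - christoffel g p l j m x * christoffel g p m i k x)

/-- The metric components `g_{ab}` at `p`. -/
def metricAt (g : LorentzMetric M) (p : M) : Matrix (Fin 4) (Fin 4) ℝ :=
  coordMetric g p (extChartAt (𝓡 4) p p)

/-- The Riemann tensor at `p`: `R_{abcd} = g(R(∂_c,∂_d)∂_b, ∂_a)`. -/
def riemann (g : LorentzMetric M) (p : M) (a b c d : Fin 4) : ℝ :=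
  ∑ l, metricAt g p a l * riemannUp g p l b c d (extChartAt (𝓡 4) p p)

/-- The scalar curvature at `p`, normalized as the sum `∑_{α<β} K(e_α ∧ e_β)` of the sectional
curvatures of the planes of an orthonormal basis, i.e. one half of `g^{ac} g^{bd} R_{abcd}`. -/
def scalarCurvature (g : LorentzMetric M) (p : M) : ℝ :=
  (1 / 2) * ∑ a, ∑ b, ∑ c, ∑ d,
    (metricAt g p)⁻¹ a c * (metricAt g p)⁻¹ b d * riemann g p a b c d

/-- Chen's invariant `Λ(0) = 2m/(m-1) · R` for the empty tuple (`k = 0`), with `m = 4`. For `k = 0`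
the infimum and the supremum over families of plane sections are both `0`, so this is also the
invariant `Λ̂(0)`. -/
def chenLambdaZero (g : LorentzMetric M) (p : M) : ℝ :=
  (2 * 4 / (4 - 1)) * scalarCurvature g p

/-! ### Extrinsic geometry of a map into pseudo-Euclidean space -/

/-- `f` restricts to a smooth isometric embedding of `U` into `(E5, eta ε)`. -/
structure IsIsometricEmbeddingOn (g : LorentzMetric M) (ε : ℝ) (f : M → E5) (U : Set M) : Prop where
  contMDiffOn : ContMDiffOn (𝓡 4) 𝓘(ℝ, E5) ∞ f U
  isEmbedding : Topology.IsEmbedding (U.domRestrict f)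
  isometric : ∀ p ∈ U, ∀ X Y : TangentSpace (𝓡 4) p,
    eta ε (mfderiv (𝓡 4) 𝓘(ℝ, E5) f p X) (mfderiv (𝓡 4) 𝓘(ℝ, E5) f p Y) = g.val p X Y

/-- `ξ` is a unit normal vector of `f` at `p`, with `η(ξ,ξ) = ε`. -/
def IsUnitNormal (ε : ℝ) (f : M → E5) (p : M) (ξ : E5) : Prop :=
  eta ε ξ ξ = ε ∧ ∀ X : TangentSpace (𝓡 4) p, eta ε (mfderiv (𝓡 4) 𝓘(ℝ, E5) f p X) ξ = 0

/-- The map `f` read in the chart at `p`. -/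
def coordMap (f : M → E5) (p : M) : E4 → E5 := f ∘ (extChartAt (𝓡 4) p).symm

/-- The components at `p` of the (normal-valued) second fundamental form
`Ω(X,Y) = ∇̃_X Y - ∇_X Y`: `Ω(∂ᵢ,∂ⱼ) = ∂ᵢ∂ⱼ f - ∑ₖ Γᵏᵢⱼ ∂ₖ f`. -/
def secondFund (g : LorentzMetric M) (f : M → E5) (p : M) (i j : Fin 4) : E5 :=
  pd i (pd j (coordMap f p)) (extChartAt (𝓡 4) p p)
    - ∑ k, christoffel g p k i j (extChartAt (𝓡 4) p p) •
        pd k (coordMap f p) (extChartAt (𝓡 4) p p)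

/-- The mean curvature vector `H = g^{ij} Ω(∂ᵢ,∂ⱼ)`. -/
def meanCurvature (g : LorentzMetric M) (f : M → E5) (p : M) : E5 :=
  ∑ i, ∑ j, (metricAt g p)⁻¹ i j • secondFund g f p i j

/-- Equality `‖H‖² = Λ(0)` at `p`. -/
def IsIdealZeroAt (g : LorentzMetric M) (ε : ℝ) (f : M → E5) (p : M) : Prop :=
  eta ε (meanCurvature g f p) (meanCurvature g f p) = chenLambdaZero g p

/-- `f` is causal-type preserving at `p` with respect to the time direction `T`. For every local
smooth unit normal field `ξ`: if `ε = 1`, the derivatives of `ξ` in the spatial directions (those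
orthogonal to `T`) are spatial; if `ε = -1`, the derivative of `ξ` along `T` is purely temporal,
i.e. tangent to the time direction. -/
def IsCausalTypePreservingAt (g : LorentzMetric M) (T : ∀ p : M, TangentSpace (𝓡 4) p)
    (ε : ℝ) (f : M → E5) (p : M) : Prop :=
  ∀ ξ : M → E5, ContMDiffAt (𝓡 4) 𝓘(ℝ, E5) ∞ ξ p → (∀ᶠ q in 𝓝 p, IsUnitNormal ε f q (ξ q)) →
    (ε = 1 → ∀ X : TangentSpace (𝓡 4) p, g.val p X (T p) = 0 →
      ∃ Y : TangentSpace (𝓡 4) p, g.val p Y (T p) = 0 ∧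
        mfderiv (𝓡 4) 𝓘(ℝ, E5) ξ p X = mfderiv (𝓡 4) 𝓘(ℝ, E5) f p Y) ∧
    (ε = -1 → ∃ c : ℝ,
      mfderiv (𝓡 4) 𝓘(ℝ, E5) ξ p (T p) = mfderiv (𝓡 4) 𝓘(ℝ, E5) f p (c • T p))

/-- `Ω_{ij} = μ g_{ij}` at `p` with respect to the unit normal `ξ`, where `Ω_{ij} = η(Ω(∂ᵢ,∂ⱼ), ξ)`,
that is `Ω(∂ᵢ,∂ⱼ) = ε Ω_{ij} ξ`. -/
def HasShapeAt (g : LorentzMetric M) (ε : ℝ) (f : M → E5) (p : M) (ξ : E5) (μ : ℝ) : Prop :=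
  IsUnitNormal ε f p ξ ∧ ∀ i j, secondFund g f p i j = (ε * (μ * metricAt g p i j)) • ξ

/-- `f` is umbilical at `p`. -/
def IsUmbilicalAt (g : LorentzMetric M) (ε : ℝ) (f : M → E5) (p : M) : Prop :=
  ∃ (ξ : E5) (μ : ℝ), HasShapeAt g ε f p ξ μ

/-- De Sitter space of radius `r`, with the metric induced by `eta 1`. -/
def deSitter (r : ℝ) : Set E5 := {y | eta 1 y y = r ^ 2}

/-- Anti-de Sitter space of radius `r`, with the metric induced by `eta (-1)`. -/
def antiDeSitter (r : ℝ) : Set E5 := {y | eta (-1) y y = -r ^ 2}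

/-- `(U, g)` is isometric to a (relatively) open subset of the hypersurface `S` of `(E5, eta ε)`
with its induced metric. -/
def IsIsometricToOpenIn (g : LorentzMetric M) (ε : ℝ) (U : Set M) (S : Set E5) : Prop :=
  ∃ φ : M → E5, IsIsometricEmbeddingOn g ε φ U ∧ ∃ W : Set E5, IsOpen W ∧ φ '' U = S ∩ W

end IdealEmbedding

end

noncomputable section

namespace IdealEmbedding

/-! ### The scalar product `eta` -/

/-! Everything rests on one local unit normal `N` and the symmetric matrix `k i j = η(∂ᵢ∂ⱼF, N)`.
With `B = G⁻¹ k` and `τ = tr B`, the mean curvature vector is `ε τ N`, and the Gauss equation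
(`LocalImmersion.gauss_equation`) gives scalar curvature `(ε/2)(τ² - tr B²)`. Equality with `Λ(0)`
therefore reads `4 tr B² = τ²`, that is, the traceless part of `B` has a square of trace zero.

For an indefinite metric this alone does not force the traceless part to vanish. Causal-type
preservation supplies what is missing: `T` is an eigendirection of `B`, so `B` commutes with the
reflection `S` reversing `T`. Since `G S` is positive definite, `S B` is self-adjoint for a
Euclidean form and has the same square as `B`; a trace-zero square then kills it
(`IsLorentzian.eq_zero_of_trace_sq`, used through `IsLorentzian.eq_smul_of_trace`).

For the umbilical half, the shape condition is equivalent to `dN = -μ dF`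
(`LocalImmersion.shape_iff`). Symmetry of second derivatives and independence of the `∂ᵢF` make `μ`
locally constant, whence `N + μ F` is a local constant `c` (`LocalImmersion.exists_ball_const`). So
locally the normal is `c - μ f`, and connectedness makes one pair `(c, μ)` valid on all of `U`,
after resolving signs (`exists_normal_of_umbilical`). The global smooth normal comes with it, and
the Gauss equation gives constant curvature. If `μ ≠ 0`, translating by `-c/μ` turns `f` into
`-ξ/μ`, which lies on the quadric `η(y,y) = ε/μ²`; its image is relatively open because the cone
over it is open near each image point (`exists_isOpen_image_eq`). -/

/-- The diagonal entries of `eta ε`. -/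
def etaSign (ε : ℝ) : Fin 5 → ℝ := ![ε, 1, 1, 1, -1]

theorem eta_eq_sum (ε : ℝ) (x y : E5) : eta ε x y = ∑ k, etaSign ε k * (x k * y k) := by
  simp [eta, etaSign, Fin.sum_univ_succ]
  ring

theorem eta_comm (ε : ℝ) (x y : E5) : eta ε x y = eta ε y x := by
  simp only [eta]; ring

/-- `eta ε` as a continuous bilinear form. -/
def etaL (ε : ℝ) : E5 →L[ℝ] E5 →L[ℝ] ℝ :=
  (LinearMap.mk₂ ℝ (eta ε) (by intros; simp only [eta, Pi.add_apply]; ring)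
    (by intros; simp only [eta, Pi.smul_apply, smul_eq_mul]; ring)
    (by intros; simp only [eta, Pi.add_apply]; ring)
    (by intros; simp only [eta, Pi.smul_apply, smul_eq_mul]; ring)).toContinuousBilinearMap

theorem etaL_apply (ε : ℝ) (x y : E5) : etaL ε x y = eta ε x y := rfl

theorem eta_add_left (ε : ℝ) (x y z : E5) : eta ε (x + y) z = eta ε x z + eta ε y z := by
  simp [← etaL_apply]

theorem eta_sub_left (ε : ℝ) (x y z : E5) : eta ε (x - y) z = eta ε x z - eta ε y z := by
  simp [← etaL_apply]

theorem eta_neg_left (ε : ℝ) (x z : E5) : eta ε (-x) z = -eta ε x z := by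
  simp [← etaL_apply]

theorem eta_smul_left (ε c : ℝ) (x z : E5) : eta ε (c • x) z = c * eta ε x z := by
  simp [← etaL_apply]

theorem eta_sum_left {ι : Type*} (ε : ℝ) (s : Finset ι) (x : ι → E5) (z : E5) :
    eta ε (∑ i ∈ s, x i) z = ∑ i ∈ s, eta ε (x i) z := by
  simp [← etaL_apply, map_sum]

theorem eta_add_right (ε : ℝ) (x y z : E5) : eta ε z (x + y) = eta ε z x + eta ε z y := by
  simp [← etaL_apply]

theorem eta_neg_right (ε : ℝ) (x z : E5) : eta ε z (-x) = -eta ε z x := by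
  simp [← etaL_apply]

theorem eta_smul_right (ε c : ℝ) (x z : E5) : eta ε z (c • x) = c * eta ε z x := by
  simp [← etaL_apply]

theorem eta_sum_right {ι : Type*} (ε : ℝ) (s : Finset ι) (x : ι → E5) (z : E5) :
    eta ε z (∑ i ∈ s, x i) = ∑ i ∈ s, eta ε z (x i) := by
  simp [← etaL_apply, map_sum]

/-! ### Gram determinants and the vector product of four vectors -/

/-- The matrix with rows `v, A 0, …, A 3`. -/
def consMatrix (v : E5) (A : Fin 4 → E5) : Matrix (Fin 5) (Fin 5) ℝ :=
  Matrix.of (Fin.cons v A : Fin 5 → E5)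

/-- The Gram matrix of four vectors with respect to `eta ε`. -/
def gram (ε : ℝ) (A : Fin 4 → E5) : Matrix (Fin 4) (Fin 4) ℝ :=
  Matrix.of fun i j ↦ eta ε (A i) (A j)

/-- Orthogonality makes the 5×5 Gram matrix of `v, A` block diagonal. That matrix is also `B D Bᵀ`
with `det D = -ε`; compare the two determinants. -/
theorem consMatrix_det_sq {ε : ℝ} {v : E5} {A : Fin 4 → E5} (h : ∀ i, eta ε (A i) v = 0) :
    (consMatrix v A).det ^ 2 * (-ε) = eta ε v v * (gram ε A).det := by
  set B := consMatrix v A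
  have h1 : (B * Matrix.diagonal (etaSign ε) * B.transpose).det = B.det ^ 2 * (-ε) := by
    rw [Matrix.det_mul, Matrix.det_mul, Matrix.det_transpose, Matrix.det_diagonal]
    simp [etaSign, Fin.prod_univ_succ]
    ring
  have h2 : ∀ i j, (B * Matrix.diagonal (etaSign ε) * B.transpose) i j = eta ε (B i) (B j) := by
    intro i j
    rw [Matrix.mul_apply, eta_eq_sum]
    refine Finset.sum_congr rfl fun k _ ↦ ?_
    rw [Matrix.mul_diagonal, Matrix.transpose_apply]
    ring
  rw [← h1, Matrix.det_succ_row_zero, Finset.sum_eq_single 0]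
  · rw [h2]
    have : (B * Matrix.diagonal (etaSign ε) * B.transpose).submatrix Fin.succ
        (Fin.succAbove 0) = gram ε A := by
      ext i j
      exact h2 i.succ j.succ
    rw [this]
    have h0 : eta ε (B 0) (B 0) = eta ε v v := rfl
    simp [h0]
  · intro j _ hj
    obtain ⟨k, rfl⟩ := Fin.exists_succ_eq.2 hj
    rw [h2]
    have : eta ε (B 0) (B k.succ) = 0 := by
      rw [eta_comm]; exact h k
    rw [this]; simp
  · simp

/-- The generalized vector product of four vectors with respect to `eta ε`. -/
def cross (ε : ℝ) (A : Fin 4 → E5) : E5 := fun k ↦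
  etaSign ε k * ((-1) ^ (k : ℕ) * ((Matrix.of A).submatrix id k.succAbove).det)

/-- Laplace expansion along the row `v`; the signs of `eta` built into `cross` cancel because they
square to one. -/
theorem eta_cross {ε : ℝ} (hε : ε = 1 ∨ ε = -1) (A : Fin 4 → E5) (v : E5) :
    eta ε (cross ε A) v = (consMatrix v A).det := by
  have hs : ∀ k, etaSign ε k * etaSign ε k = 1 := by
    intro k; rcases hε with rfl | rfl <;> fin_cases k <;> simp [etaSign]
  rw [eta_eq_sum, Matrix.det_succ_row_zero]
  refine Finset.sum_congr rfl fun k _ ↦ ?_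
  have : (consMatrix v A).submatrix Fin.succ k.succAbove
      = (Matrix.of A).submatrix id k.succAbove := by
    ext i j; simp [consMatrix]
  rw [this]
  have h0 : consMatrix v A 0 k = v k := by simp [consMatrix]
  rw [h0, cross]
  linear_combination ((-1) ^ (k : ℕ) * ((Matrix.of A).submatrix id k.succAbove).det * v k) * hs k

theorem eta_cross_self_eq_zero {ε : ℝ} (hε : ε = 1 ∨ ε = -1) (A : Fin 4 → E5) (i : Fin 4) :
    eta ε (cross ε A) (A i) = 0 := by
  rw [eta_cross hε]
  refine Matrix.det_zero_of_row_eq (i := 0) (j := i.succ) (Fin.succ_ne_zero i).symm ?_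
  ext k; simp [consMatrix]

theorem linearIndependent_of_gram {ε : ℝ} {A : Fin 4 → E5} (h : (gram ε A).det ≠ 0) :
    LinearIndependent ℝ A := by
  rw [Fintype.linearIndependent_iff]
  intro c hc
  have : (gram ε A).mulVec c = 0 := by
    ext i
    have := congrArg (eta ε (A i)) hc
    simp only [eta_sum_right, eta_smul_right] at this
    simp only [Matrix.mulVec, dotProduct, gram, Matrix.of_apply, Pi.zero_apply]
    have h0 : eta ε (A i) 0 = 0 := by simp [eta]
    rw [h0] at this
    rw [← this]
    exact Finset.sum_congr rfl fun _ _ ↦ mul_comm _ _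
  have h0 := Matrix.eq_zero_of_mulVec_eq_zero h this
  exact fun i ↦ congrFun h0 i

theorem consMatrix_det_ne_zero_iff (v : E5) (A : Fin 4 → E5) :
    (consMatrix v A).det ≠ 0 ↔ LinearIndependent ℝ (Fin.cons v A : Fin 5 → E5) := by
  rw [← isUnit_iff_ne_zero, ← Matrix.isUnit_iff_isUnit_det,
    ← Matrix.linearIndependent_rows_iff_isUnit]
  rfl

theorem cross_ne_zero {ε : ℝ} (hε : ε = 1 ∨ ε = -1) {A : Fin 4 → E5} (h : (gram ε A).det ≠ 0) :
    cross ε A ≠ 0 := by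
  intro h0
  have hA := linearIndependent_of_gram h
  obtain ⟨v, hv⟩ : ∃ v, v ∉ Submodule.span ℝ (Set.range A) := by
    by_contra! hall
    have h1 : Submodule.span ℝ (Set.range A) = ⊤ := by
      rw [eq_top_iff]; intro x _; exact hall x
    have h2 := finrank_span_eq_card hA
    rw [h1, finrank_top] at h2
    simp at h2
  have h3 : LinearIndependent ℝ (Fin.cons v A : Fin 5 → E5) := hA.finCons hv
  rw [← consMatrix_det_ne_zero_iff, ← eta_cross hε, h0] at h3
  simp [eta] at h3

/-- Fixes the causal character of the normal. For `ν = cross ε A` the determinant in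
`consMatrix_det_sq` is itself `η(ν,ν)`, so cancelling one factor leaves `-ε η(ν,ν) = det (gram ε
A)`. -/
theorem eta_cross_cross_pos {ε : ℝ} (hε : ε = 1 ∨ ε = -1) {A : Fin 4 → E5}
    (h : (gram ε A).det < 0) : 0 < ε * eta ε (cross ε A) (cross ε A) := by
  set ν := cross ε A
  have hν : ∀ i, eta ε ν (A i) = 0 := eta_cross_self_eq_zero hε A
  have h1 := consMatrix_det_sq (ε := ε) (v := ν) (A := A) (fun i ↦ by rw [eta_comm]; exact hν i)
  rw [← eta_cross hε A ν] at h1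
  change eta ε ν ν ^ 2 * (-ε) = eta ε ν ν * (gram ε A).det at h1
  -- If `η(ν,ν)` vanished, `ν` would lie in the span of `A` and be orthogonal to it, contradicting
  -- nondegeneracy since `ν ≠ 0`.
  have hD : eta ε ν ν ≠ 0 := by
    intro hD
    have h2 : ¬ LinearIndependent ℝ (Fin.cons ν A : Fin 5 → E5) := by
      rw [← consMatrix_det_ne_zero_iff, ← eta_cross hε A ν, not_not]
      exact hD
    have hA := linearIndependent_of_gram h.ne
    have h3 : ν ∈ Submodule.span ℝ (Set.range A) := by
      by_contra hv
      exact h2 (hA.finCons hv)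
    obtain ⟨c, hc⟩ := (Submodule.mem_span_range_iff_exists_fun ℝ).1 h3
    have : (gram ε A).mulVec c = 0 := by
      ext i
      have := hν i
      rw [← hc, eta_comm] at this
      simp only [eta_sum_right, eta_smul_right] at this
      simp only [Matrix.mulVec, dotProduct, gram, Matrix.of_apply, Pi.zero_apply]
      rw [← this]
      exact Finset.sum_congr rfl fun _ _ ↦ mul_comm _ _
    have h0 := Matrix.eq_zero_of_mulVec_eq_zero h.ne this
    refine cross_ne_zero hε h.ne ?_
    change ν = 0
    rw [← hc, h0]; simp
  have h2 : eta ε ν ν * (-ε) = (gram ε A).det := by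
    apply mul_left_cancel₀ hD
    rw [← h1]; ring
  linarith

/-- A vector orthogonal to a nondegenerate frame and to its unit normal vanishes. -/
theorem eq_zero_of_eta_eq_zero {ε : ℝ} (hε : ε = 1 ∨ ε = -1) {A : Fin 4 → E5} {ξ v : E5}
    (h : (gram ε A).det ≠ 0) (hξ : ∀ i, eta ε (A i) ξ = 0) (hξξ : eta ε ξ ξ = ε)
    (hv : ∀ i, eta ε (A i) v = 0) (hvξ : eta ε ξ v = 0) : v = 0 := by
  have hε0 : ε ≠ 0 := by rcases hε with rfl | rfl <;> norm_num
  have h1 := consMatrix_det_sq hξ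
  have hB : (consMatrix ξ A).det ≠ 0 := by
    intro h0
    rw [h0, hξξ] at h1
    have : ε * (gram ε A).det ≠ 0 := mul_ne_zero hε0 h
    apply this; rw [← h1]; ring
  have h2 : (consMatrix ξ A).mulVec (fun k ↦ etaSign ε k * v k) = 0 := by
    ext i
    have h3 : (consMatrix ξ A).mulVec (fun k ↦ etaSign ε k * v k) i
        = eta ε (consMatrix ξ A i) v := by
      rw [eta_eq_sum]
      simp only [Matrix.mulVec, dotProduct]
      exact Finset.sum_congr rfl fun k _ ↦ by ring
    rw [h3]
    refine Fin.cases ?_ (fun j ↦ ?_) i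
    · exact hvξ
    · exact hv j
  have h0 := Matrix.eq_zero_of_mulVec_eq_zero hB h2
  ext k
  have hs : etaSign ε k * etaSign ε k = 1 := by
    rcases hε with rfl | rfl <;> fin_cases k <;> simp [etaSign]
  have := congrFun h0 k
  simp only [Pi.zero_apply] at this ⊢
  linear_combination etaSign ε k * this - v k * hs

theorem sq_eq_one_of {ε : ℝ} (hε : ε = 1 ∨ ε = -1) : ε * ε = 1 := by
  rcases hε with rfl | rfl <;> norm_num

/-- A vector orthogonal to a nondegenerate frame is a multiple of the unit normal. -/
theorem eq_smul_of_eta_eq_zero {ε : ℝ} (hε : ε = 1 ∨ ε = -1) {A : Fin 4 → E5} {ξ v : E5}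
    (h : (gram ε A).det ≠ 0) (hξ : ∀ i, eta ε (A i) ξ = 0) (hξξ : eta ε ξ ξ = ε)
    (hv : ∀ i, eta ε (A i) v = 0) : v = (ε * eta ε v ξ) • ξ := by
  rw [← sub_eq_zero]
  refine eq_zero_of_eta_eq_zero hε h hξ hξξ (fun i ↦ ?_) ?_
  · rw [eta_comm, eta_sub_left, eta_smul_left, eta_comm ε v (A i), hv, eta_comm ε ξ (A i), hξ]
    ring
  · rw [eta_comm, eta_sub_left, eta_smul_left, hξξ]
    linear_combination (-eta ε v ξ) * sq_eq_one_of hε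

/-! ### Partial derivatives -/

section PartialDerivatives

variable {V : Type*} [NormedAddCommGroup V] [NormedSpace ℝ V]

theorem fderiv_eq_sum_pd (h : E4 → V) (x v : E4) : fderiv ℝ h x v = ∑ i, v i • pd i h x := by
  have hv : v = ∑ i, v i • e i := by
    ext k
    simp [e, Finset.sum_apply, Pi.single_apply]
  conv_lhs => rw [hv]
  simp [pd]

theorem pd_eventuallyEq {h k : E4 → V} {x : E4} (hk : h =ᶠ[𝓝 x] k) (i : Fin 4) :
    pd i h x = pd i k x := by
  rw [pd, pd, hk.fderiv_eq]

theorem pd_congr_of_isOpen {h k : E4 → V} {s : Set E4} (hs : IsOpen s) (hk : ∀ x ∈ s, h x = k x)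
    {x : E4} (hx : x ∈ s) (i : Fin 4) : pd i h x = pd i k x :=
  pd_eventuallyEq (Filter.eventuallyEq_of_mem (hs.mem_nhds hx) hk) i

theorem contDiffOn_pd {h : E4 → V} {s : Set E4} (hs : IsOpen s) (hh : ContDiffOn ℝ ∞ h s)
    (i : Fin 4) : ContDiffOn ℝ ∞ (pd i h) s :=
  (hh.fderiv_of_isOpen (m := ∞) hs (by simp)).clm_apply contDiffOn_const

theorem ContDiffOn.differentiableAt_of_isOpen {h : E4 → V} {s : Set E4} (hh : ContDiffOn ℝ ∞ h s)
    (hs : IsOpen s) {x : E4} (hx : x ∈ s) : DifferentiableAt ℝ h x :=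
  (hh.contDiffAt (hs.mem_nhds hx)).differentiableAt (by simp)

theorem pd_comm {h : E4 → V} {s : Set E4} (hs : IsOpen s) (hh : ContDiffOn ℝ ∞ h s)
    {x : E4} (hx : x ∈ s) (i j : Fin 4) : pd i (pd j h) x = pd j (pd i h) x := by
  have hd : DifferentiableAt ℝ (fderiv ℝ h) x :=
    ((hh.fderiv_of_isOpen (m := ∞) hs (by simp)).contDiffAt (hs.mem_nhds hx)).differentiableAt
      (by simp)
  have key : ∀ i j, pd i (pd j h) x = fderiv ℝ (fderiv ℝ h) x (e i) (e j) := by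
    intro i j
    change fderiv ℝ (fun y ↦ fderiv ℝ h y (e j)) x (e i) = _
    rw [fderiv_clm_apply hd (differentiableAt_const _)]
    simp
  rw [key, key]
  exact ((hh.contDiffAt (hs.mem_nhds hx)).isSymmSndFDerivAt
    (by simpa using WithTop.coe_le_coe.2 (le_top (a := (2 : ℕ∞))))) (e i) (e j)

theorem pd_add {h k : E4 → V} {x : E4} (hh : DifferentiableAt ℝ h x) (hk : DifferentiableAt ℝ k x)
    (i : Fin 4) : pd i (fun y ↦ h y + k y) x = pd i h x + pd i k x := by
  simp [pd, fderiv_fun_add hh hk]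

theorem pd_smul {c : E4 → ℝ} {k : E4 → V} {x : E4} (hc : DifferentiableAt ℝ c x)
    (hk : DifferentiableAt ℝ k x) (i : Fin 4) :
    pd i (fun y ↦ c y • k y) x = c x • pd i k x + pd i c x • k x := by
  simp [pd, fderiv_fun_smul hc hk]

theorem pd_sum {ι : Type*} {u : Finset ι} {h : ι → E4 → V} {x : E4}
    (hh : ∀ a ∈ u, DifferentiableAt ℝ (h a) x) (i : Fin 4) :
    pd i (fun y ↦ ∑ a ∈ u, h a y) x = ∑ a ∈ u, pd i (h a) x := by
  simp [pd, fderiv_fun_sum hh]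

theorem pd_const (c : V) (x : E4) (i : Fin 4) : pd i (fun _ ↦ c) x = 0 := by
  simp [pd]

theorem pd_eta (ε : ℝ) {a b : E4 → E5} {x : E4} (ha : DifferentiableAt ℝ a x)
    (hb : DifferentiableAt ℝ b x) (i : Fin 4) :
    pd i (fun y ↦ eta ε (a y) (b y)) x = eta ε (pd i a x) (b x) + eta ε (a x) (pd i b x) := by
  have := (etaL ε).fderiv_of_bilinear ha hb
  simp only [etaL_apply] at this
  rw [pd, this]
  simp [pd, etaL_apply]
  ring

theorem contDiffOn_eta (ε : ℝ) {a b : E4 → E5} {s : Set E4} (ha : ContDiffOn ℝ ∞ a s)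
    (hb : ContDiffOn ℝ ∞ b s) : ContDiffOn ℝ ∞ (fun y ↦ eta ε (a y) (b y)) s := by
  unfold eta
  fun_prop

end PartialDerivatives

theorem contDiffOn_det {n : ℕ} {A : E4 → Matrix (Fin n) (Fin n) ℝ} {s : Set E4}
    (hA : ∀ i j, ContDiffOn ℝ ∞ (fun x ↦ A x i j) s) : ContDiffOn ℝ ∞ (fun x ↦ (A x).det) s := by
  simp only [Matrix.det_apply]
  refine ContDiffOn.sum fun σ _ ↦ ContDiffOn.const_smul _ (contDiffOn_prod fun i _ ↦ hA _ _)

/-- By Cramer's rule, each entry is a minor divided by the determinant. -/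
theorem contDiffOn_matrix_inv {A : E4 → Matrix (Fin 4) (Fin 4) ℝ} {s : Set E4}
    (hA : ∀ i j, ContDiffOn ℝ ∞ (fun x ↦ A x i j) s) (hdet : ∀ x ∈ s, (A x).det ≠ 0)
    (i j : Fin 4) : ContDiffOn ℝ ∞ (fun x ↦ (A x)⁻¹ i j) s := by
  simp only [Matrix.inv_def, Matrix.smul_apply, smul_eq_mul, Ring.inverse_eq_inv',
    Matrix.adjugate_apply]
  refine ((contDiffOn_det hA).inv hdet).mul (contDiffOn_det fun a b ↦ ?_)
  by_cases h : a = j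
  · subst h; simpa using contDiffOn_const
  · simpa [Matrix.updateRow_ne h] using hA a b

/-! ### Christoffel symbols and curvature of a matrix-valued function -/

/-- Christoffel symbols of the metric coefficients `G`. -/
def chr (G : E4 → Matrix (Fin 4) (Fin 4) ℝ) (k i j : Fin 4) (x : E4) : ℝ :=
  (1 / 2) * ∑ l, (G x)⁻¹ k l *
    (pd i (fun y ↦ G y j l) x + pd j (fun y ↦ G y i l) x - pd l (fun y ↦ G y i j) x)

/-- Curvature components of the metric coefficients `G`. -/
def riemUp (G : E4 → Matrix (Fin 4) (Fin 4) ℝ) (l k i j : Fin 4) (x : E4) : ℝ :=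
  pd i (chr G l j k) x - pd j (chr G l i k) x
    + ∑ m, (chr G l i m x * chr G m j k x - chr G l j m x * chr G m i k x)

/-! ### Gauss and Weingarten equations for an immersed coordinate patch -/

/-- `F` is an isometric immersion of the open set `V` with metric coefficients `G`, where `G` has
negative determinant. -/
structure LocalImmersion (ε : ℝ) (V : Set E4) (F : E4 → E5)
    (G : E4 → Matrix (Fin 4) (Fin 4) ℝ) : Prop where
  sign : ε = 1 ∨ ε = -1
  isOpen : IsOpen V
  contDiffOn : ContDiffOn ℝ ∞ F V
  gram_eq : ∀ x ∈ V, G x = gram ε fun i ↦ pd i F x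
  det_neg : ∀ x ∈ V, (G x).det < 0

/-- `N` is a smooth unit normal field of `F` on `V`. -/
structure LocalNormal (ε : ℝ) (V : Set E4) (F N : E4 → E5) : Prop where
  contDiffOn : ContDiffOn ℝ ∞ N V
  unit : ∀ x ∈ V, eta ε (N x) (N x) = ε
  orth : ∀ x ∈ V, ∀ i, eta ε (pd i F x) (N x) = 0

namespace LocalImmersion

variable {ε : ℝ} {V : Set E4} {F N : E4 → E5} {G : E4 → Matrix (Fin 4) (Fin 4) ℝ}

theorem apply_eq (h : LocalImmersion ε V F G) {x : E4} (hx : x ∈ V) (i j : Fin 4) :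
    G x i j = eta ε (pd i F x) (pd j F x) := by
  rw [h.gram_eq x hx]; rfl

theorem gram_det_neg (h : LocalImmersion ε V F G) {x : E4} (hx : x ∈ V) :
    (gram ε fun i ↦ pd i F x).det < 0 := by
  rw [← h.gram_eq x hx]; exact h.det_neg x hx

theorem exists_normal (h : LocalImmersion ε V F G) : ∃ N, LocalNormal ε V F N := by
  set ν : E4 → E5 := fun x ↦ cross ε fun i ↦ pd i F x with hνdef
  have hν : ContDiffOn ℝ ∞ ν V := by
    refine contDiffOn_pi.2 fun k ↦ contDiffOn_const.mul (contDiffOn_const.mul ?_)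
    exact contDiffOn_det fun i j ↦ contDiffOn_pi.1 (contDiffOn_pd h.isOpen h.contDiffOn i) _
  have hpos : ∀ x ∈ V, 0 < ε * eta ε (ν x) (ν x) := fun x hx ↦
    eta_cross_cross_pos h.sign (h.gram_det_neg hx)
  refine ⟨fun x ↦ (√(ε * eta ε (ν x) (ν x)))⁻¹ • ν x, ?_, fun x hx ↦ ?_, fun x hx i ↦ ?_⟩
  · refine ContDiffOn.smul (ContDiffOn.inv (ContDiffOn.sqrt ?_ fun x hx ↦ (hpos x hx).ne') ?_) hν
    · exact contDiffOn_const.mul (contDiffOn_eta ε hν hν)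
    · exact fun x hx ↦ (Real.sqrt_pos.2 (hpos x hx)).ne'
  · have h1 := hpos x hx
    rw [eta_smul_left, eta_smul_right, ← mul_assoc, ← mul_inv, Real.mul_self_sqrt h1.le]
    have hD : eta ε (ν x) (ν x) ≠ 0 := by
      intro h0; rw [h0] at h1; simp at h1
    have hε0 : ε ≠ 0 := by
      rcases h.sign with h | h <;> rw [h] <;> norm_num
    field_simp
    linarith [sq_eq_one_of h.sign]
  · have h0 : eta ε (ν x) (pd i F x) = 0 := eta_cross_self_eq_zero h.sign (fun i ↦ pd i F x) i
    rw [eta_smul_right, eta_comm ε (pd i F x), h0, mul_zero]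

theorem differentiableAt (h : LocalImmersion ε V F G) {x : E4} (hx : x ∈ V) :
    DifferentiableAt ℝ F x := ContDiffOn.differentiableAt_of_isOpen h.contDiffOn h.isOpen hx

theorem contDiffOn_pd_pd (h : LocalImmersion ε V F G) (i j : Fin 4) :
    ContDiffOn ℝ ∞ (pd i (pd j F)) V :=
  contDiffOn_pd h.isOpen (contDiffOn_pd h.isOpen h.contDiffOn j) i

theorem differentiableAt_pd (h : LocalImmersion ε V F G) {x : E4} (hx : x ∈ V) (i : Fin 4) :
    DifferentiableAt ℝ (pd i F) x :=
  ContDiffOn.differentiableAt_of_isOpen (contDiffOn_pd h.isOpen h.contDiffOn i) h.isOpen hx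

theorem metric_symm (h : LocalImmersion ε V F G) {x : E4} (hx : x ∈ V) (i j : Fin 4) :
    G x i j = G x j i := by
  rw [h.apply_eq hx, h.apply_eq hx, eta_comm]

theorem contDiffOn_metric (h : LocalImmersion ε V F G) (i j : Fin 4) :
    ContDiffOn ℝ ∞ (fun x ↦ G x i j) V :=
  (contDiffOn_eta ε (contDiffOn_pd h.isOpen h.contDiffOn i)
    (contDiffOn_pd h.isOpen h.contDiffOn j)).congr fun _ hx ↦ h.apply_eq hx i j

theorem pd_metric (h : LocalImmersion ε V F G) {x : E4} (hx : x ∈ V) (l i j : Fin 4) :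
    pd l (fun y ↦ G y i j) x = eta ε (pd l (pd i F) x) (pd j F x)
      + eta ε (pd l (pd j F) x) (pd i F x) := by
  rw [pd_congr_of_isOpen h.isOpen (fun y hy ↦ h.apply_eq hy i j) hx,
    pd_eta ε (h.differentiableAt_pd hx i) (h.differentiableAt_pd hx j), eta_comm ε (pd i F x)]

/-- Expanding the derivatives of `G = ⟨∂F, ∂F⟩`, all terms cancel except two copies of `⟨∂ᵢ∂ⱼF,
∂ₗF⟩`. -/
theorem chr_eq (h : LocalImmersion ε V F G) {x : E4} (hx : x ∈ V) (k i j : Fin 4) :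
    chr G k i j x = ∑ l, (G x)⁻¹ k l * eta ε (pd i (pd j F) x) (pd l F x) := by
  rw [chr, Finset.mul_sum]
  refine Finset.sum_congr rfl fun l _ ↦ ?_
  rw [h.pd_metric hx, h.pd_metric hx, h.pd_metric hx, pd_comm h.isOpen h.contDiffOn hx j i,
    pd_comm h.isOpen h.contDiffOn hx l i, pd_comm h.isOpen h.contDiffOn hx l j]
  ring

theorem contDiffOn_chr (h : LocalImmersion ε V F G) (k i j : Fin 4) :
    ContDiffOn ℝ ∞ (chr G k i j) V := by
  refine ContDiffOn.congr ?_ fun x hx ↦ h.chr_eq hx k i j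
  refine ContDiffOn.sum fun l _ ↦ ContDiffOn.mul ?_ ?_
  · exact contDiffOn_matrix_inv h.contDiffOn_metric (fun x hx ↦ (h.det_neg x hx).ne) k l
  · exact contDiffOn_eta ε (h.contDiffOn_pd_pd i j) (contDiffOn_pd h.isOpen h.contDiffOn l)

theorem sum_metric_mul_inv (h : LocalImmersion ε V F G) {x : E4} (hx : x ∈ V) (w : Fin 4 → ℝ)
    (a : Fin 4) : ∑ k, G x a k * (∑ l, (G x)⁻¹ k l * w l) = w a := by
  have h1 : (G x).mulVec ((G x)⁻¹.mulVec w) = w := by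
    rw [Matrix.mulVec_mulVec, Matrix.mul_nonsing_inv _ (h.det_neg x hx).ne.isUnit,
      Matrix.one_mulVec]
  exact congrFun h1 a

theorem sum_metric_mul_chr (h : LocalImmersion ε V F G) {x : E4} (hx : x ∈ V) (a i j : Fin 4) :
    ∑ k, G x a k * chr G k i j x = eta ε (pd i (pd j F) x) (pd a F x) := by
  simp only [h.chr_eq hx]
  exact h.sum_metric_mul_inv hx (fun l ↦ eta ε (pd i (pd j F) x) (pd l F x)) a

/-- The Christoffel part is exactly the tangential projection (`sum_metric_mul_chr`), so the
remainder is orthogonal to the frame and hence a multiple of `N`. -/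
theorem gauss_formula (h : LocalImmersion ε V F G) (hN : LocalNormal ε V F N) {x : E4}
    (hx : x ∈ V) (i j : Fin 4) :
    pd i (pd j F) x = ∑ k, chr G k i j x • pd k F x
      + (ε * eta ε (pd i (pd j F) x) (N x)) • N x := by
  have h1 := eq_smul_of_eta_eq_zero h.sign (h.gram_det_neg hx).ne (hN.orth x hx) (hN.unit x hx)
    (v := pd i (pd j F) x - ∑ k, chr G k i j x • pd k F x) (fun a ↦ by
      rw [eta_comm, eta_sub_left, eta_sum_left, ← h.sum_metric_mul_chr hx, sub_eq_zero]
      refine Finset.sum_congr rfl fun k _ ↦ ?_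
      rw [eta_smul_left, h.apply_eq hx, eta_comm, mul_comm])
  have h2 : eta ε (pd i (pd j F) x - ∑ k, chr G k i j x • pd k F x) (N x)
      = eta ε (pd i (pd j F) x) (N x) := by
    rw [eta_sub_left, eta_sum_left]
    simp [eta_smul_left, hN.orth x hx]
  rw [h2] at h1
  rw [← h1]; abel

theorem eta_pd_normal (h : LocalImmersion ε V F G) (hN : LocalNormal ε V F N) {x : E4}
    (hx : x ∈ V) (i j : Fin 4) :
    eta ε (pd i N x) (pd j F x) = -eta ε (pd i (pd j F) x) (N x) := by
  have h1 := pd_congr_of_isOpen h.isOpen (fun y hy ↦ hN.orth y hy j) hx i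
  rw [pd_eta ε (h.differentiableAt_pd hx j)
    (ContDiffOn.differentiableAt_of_isOpen hN.contDiffOn h.isOpen hx), pd_const,
    eta_comm ε (pd j F x)] at h1
  linarith

theorem eta_pd_normal_normal (h : LocalImmersion ε V F G) (hN : LocalNormal ε V F N) {x : E4}
    (hx : x ∈ V) (i : Fin 4) : eta ε (N x) (pd i N x) = 0 := by
  have hd := ContDiffOn.differentiableAt_of_isOpen hN.contDiffOn h.isOpen hx
  have h1 := pd_congr_of_isOpen h.isOpen (fun y hy ↦ hN.unit y hy) hx i
  rw [pd_eta ε hd hd, pd_const, eta_comm ε (pd i N x)] at h1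
  linarith

/-- Obtained by differentiating the Gauss formula and pairing with `∂ₐF`. The derivative of the
normal coefficient drops out, and the derivative of `N` yields the quadratic term. Antisymmetrizing
in `c, d` then gives the Gauss equation, as third derivatives commute. -/
theorem eta_pd_pd_pd (h : LocalImmersion ε V F G) (hN : LocalNormal ε V F N) {x : E4}
    (hx : x ∈ V) (a b c d : Fin 4) :
    eta ε (pd c (pd d (pd b F)) x) (pd a F x) =
      ∑ l, G x a l * (pd c (chr G l d b) x + ∑ m, chr G l c m x * chr G m d b x)
        - ε * (eta ε (pd c (pd a F) x) (N x) * eta ε (pd d (pd b F) x) (N x)) := by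
  have hΓ := fun l ↦ ContDiffOn.differentiableAt_of_isOpen (h.contDiffOn_chr l d b) h.isOpen hx
  have hNd := ContDiffOn.differentiableAt_of_isOpen hN.contDiffOn h.isOpen hx
  have hh : DifferentiableAt ℝ (fun y ↦ ε * eta ε (pd d (pd b F) y) (N y)) x :=
    ContDiffOn.differentiableAt_of_isOpen
      (contDiffOn_const.mul (contDiffOn_eta ε (h.contDiffOn_pd_pd d b) hN.contDiffOn)) h.isOpen hx
  have h1 := pd_congr_of_isOpen h.isOpen (fun y hy ↦ h.gauss_formula hN hy d b) hx c
  have hs : ∀ l ∈ Finset.univ, DifferentiableAt ℝ (fun y ↦ chr G l d b y • pd l F y) x :=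
    fun l _ ↦ (hΓ l).smul (h.differentiableAt_pd hx l)
  rw [pd_add (DifferentiableAt.fun_sum hs) (hh.fun_smul hNd), pd_sum hs, pd_smul hh hNd] at h1
  have h2 : ∀ l, pd c (fun y ↦ chr G l d b y • pd l F y) x
      = chr G l d b x • pd c (pd l F) x + pd c (chr G l d b) x • pd l F x :=
    fun l ↦ pd_smul (hΓ l) (h.differentiableAt_pd hx l) c
  simp only [h2] at h1
  rw [h1]
  simp only [eta_add_left, eta_sum_left, eta_smul_left, ← h.sum_metric_mul_chr hx,
    h.eta_pd_normal hN hx]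
  rw [eta_comm ε (N x), hN.orth x hx]
  simp only [← h.apply_eq hx, h.metric_symm hx _ a, mul_add, Finset.sum_add_distrib,
    Finset.mul_sum]
  rw [Finset.sum_comm (f := fun l m ↦ chr G l d b x * (G x a m * chr G m c l x))]
  have h3 : ∀ l m, chr G m d b x * (G x a l * chr G l c m x)
      = G x a l * (chr G l c m x * chr G m d b x) := fun l m ↦ by ring
  simp only [h3]
  have h4 : ∀ l, pd c (chr G l d b) x * G x a l = G x a l * pd c (chr G l d b) x :=
    fun l ↦ mul_comm _ _
  simp only [h4]
  ring

/-- The Gauss equation. -/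
theorem gauss_equation (h : LocalImmersion ε V F G) (hN : LocalNormal ε V F N) {x : E4}
    (hx : x ∈ V) (a b c d : Fin 4) :
    ∑ l, G x a l * riemUp G l b c d x =
      ε * (eta ε (pd a (pd c F) x) (N x) * eta ε (pd b (pd d F) x) (N x)
        - eta ε (pd a (pd d F) x) (N x) * eta ε (pd b (pd c F) x) (N x)) := by
  have h1 := h.eta_pd_pd_pd hN hx a b c d
  have h2 := h.eta_pd_pd_pd hN hx a b d c
  rw [pd_comm h.isOpen (contDiffOn_pd h.isOpen h.contDiffOn b) hx d c, h1] at h2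
  have h3 : ∑ l, G x a l * riemUp G l b c d x =
      ∑ l, G x a l * (pd c (chr G l d b) x + ∑ m, chr G l c m x * chr G m d b x)
      - ∑ l, G x a l * (pd d (chr G l c b) x + ∑ m, chr G l d m x * chr G m c b x) := by
    rw [← Finset.sum_sub_distrib]
    refine Finset.sum_congr rfl fun l _ ↦ ?_
    rw [riemUp, Finset.sum_sub_distrib]
    ring
  rw [h3, pd_comm h.isOpen h.contDiffOn hx a c, pd_comm h.isOpen h.contDiffOn hx a d,
    pd_comm h.isOpen h.contDiffOn hx b c, pd_comm h.isOpen h.contDiffOn hx b d]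
  linarith

/-- The second fundamental form is `μ` times the metric exactly if the normal has derivative
`-μ • dF`. -/
theorem shape_iff (h : LocalImmersion ε V F G) (hN : LocalNormal ε V F N) {x : E4} (hx : x ∈ V)
    (μ : ℝ) : (∀ i j, pd i (pd j F) x - ∑ k, chr G k i j x • pd k F x
      = (ε * (μ * G x i j)) • N x) ↔ ∀ i, pd i N x = -μ • pd i F x := by
  have hε0 : ε ≠ 0 := by
    rcases h.sign with h | h <;> rw [h] <;> norm_num
  have hN0 : N x ≠ 0 := by
    intro h0
    have := hN.unit x hx
    rw [h0] at this
    exact hε0 (by rw [← this]; simp [eta])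
  have h1 : ∀ i j, pd i (pd j F) x - ∑ k, chr G k i j x • pd k F x
      = (ε * eta ε (pd i (pd j F) x) (N x)) • N x := fun i j ↦ by
    rw [sub_eq_iff_eq_add']; exact h.gauss_formula hN hx i j
  simp only [h1]
  constructor
  · intro h2 i
    rw [neg_smul, ← add_eq_zero_iff_eq_neg]
    refine eq_zero_of_eta_eq_zero h.sign (h.gram_det_neg hx).ne (hN.orth x hx) (hN.unit x hx)
      (fun j ↦ ?_) ?_
    · have h3 := mul_left_cancel₀ hε0 (smul_left_injective ℝ hN0 (h2 i j))
      rw [eta_add_right, eta_smul_right, eta_comm, h.eta_pd_normal hN hx, h3, ← h.apply_eq hx,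
        h.metric_symm hx]
      ring
    · rw [eta_add_right, eta_smul_right, h.eta_pd_normal_normal hN hx, eta_comm, hN.orth x hx]
      ring
  · intro h2 i j
    have h3 := h.eta_pd_normal hN hx i j
    rw [h2, eta_smul_left, ← h.apply_eq hx] at h3
    rw [show eta ε (pd i (pd j F) x) (N x) = μ * G x i j by linarith]

theorem eta_pd_pd_eq (h : LocalImmersion ε V F G) (hN : LocalNormal ε V F N) {x : E4} (hx : x ∈ V)
    {μ : ℝ} (hμ : ∀ i, pd i N x = -μ • pd i F x) (i j : Fin 4) :
    eta ε (pd i (pd j F) x) (N x) = μ * G x i j := by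
  have h3 := h.eta_pd_normal hN hx i j
  rw [hμ, eta_smul_left, ← h.apply_eq hx] at h3
  linarith

theorem linearIndependent_pd (h : LocalImmersion ε V F G) {x : E4} (hx : x ∈ V) :
    LinearIndependent ℝ fun i ↦ pd i F x :=
  linearIndependent_of_gram (h.gram_det_neg hx).ne

/-- The umbilical factor is locally constant, and so is the corresponding combination of the
normal and the position vector. -/
theorem exists_ball_const (h : LocalImmersion ε V F G) (hN : ContDiffOn ℝ ∞ N V)
    {μ : E4 → ℝ} (hμ : ∀ x ∈ V, ∀ i, pd i N x = -μ x • pd i F x) {x : E4} (hx : x ∈ V) :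
    ∃ r > 0, Metric.ball x r ⊆ V ∧
      ∀ y ∈ Metric.ball x r, μ y = μ x ∧ N y + μ x • F y = N x + μ x • F x := by
  -- No regularity of `μ` is given: near `x` it is the quotient `-(∂₀N)ₖ / (∂₀F)ₖ` for a component
  -- `k` in which `∂₀F` does not vanish.
  have hdiff : ∀ x ∈ V, DifferentiableAt ℝ μ x := by
    intro x hx
    obtain ⟨k, hk⟩ : ∃ k, pd 0 F x k ≠ 0 := by
      by_contra! h0
      exact (h.linearIndependent_pd hx).ne_zero 0 (funext h0)
    have hF : DifferentiableAt ℝ (fun y ↦ pd 0 F y k) x := differentiableAt_pi.1 (h.differentiableAt_pd hx 0) k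
    have hN' : DifferentiableAt ℝ (fun y ↦ pd 0 N y k) x := differentiableAt_pi.1 (ContDiffOn.differentiableAt_of_isOpen
      (contDiffOn_pd h.isOpen hN 0) h.isOpen hx) k
    refine (hN'.fun_neg.fun_mul (hF.fun_inv hk)).congr_of_eventuallyEq ?_
    filter_upwards [h.isOpen.mem_nhds hx, hF.continuousAt.eventually_ne hk] with y hy hyk
    have := congrFun (hμ y hy 0) k
    simp only [Pi.smul_apply, smul_eq_mul] at this
    rw [this]
    field_simp
  have hzero : ∀ x ∈ V, fderiv ℝ μ x = 0 := by
    intro x hx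
    have key : ∀ i j, pd i (pd j N) x = -μ x • pd i (pd j F) x + -pd i μ x • pd j F x := by
      intro i j
      rw [pd_congr_of_isOpen h.isOpen (fun y hy ↦ hμ y hy j) hx,
        pd_smul (c := fun y ↦ -μ y) (hdiff x hx).neg (h.differentiableAt_pd hx j)]
      simp [pd, fderiv_fun_neg]
    have hpd : ∀ i, pd i μ x = 0 := by
      intro i
      -- A second index is needed: `∂ᵢ∂ⱼN = ∂ⱼ∂ᵢN` reduces to `∂ᵢμ ∂ⱼF = ∂ⱼμ ∂ᵢF`, and for `i ≠ j`
      -- independence forces both coefficients to vanish.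
      obtain ⟨j, hj⟩ := exists_ne i
      have h1 := key i j
      rw [pd_comm h.isOpen hN hx, key j i, pd_comm h.isOpen h.contDiffOn hx j i] at h1
      have h2 := add_left_cancel h1
      have h3 := Fintype.linearIndependent_iff.1 (h.linearIndependent_pd hx)
        (Pi.single j (-pd i μ x) + Pi.single i (pd j μ x)) (by
          simp only [Pi.add_apply, add_smul, Finset.sum_add_distrib, Pi.single_apply, ite_smul,
            zero_smul, Finset.sum_ite_eq', Finset.mem_univ, if_true]
          rw [← h2, neg_smul, neg_add_cancel]) j
      simpa [Pi.single_apply, hj] using h3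
    ext v
    rw [fderiv_eq_sum_pd]
    simp [hpd]
  obtain ⟨r, hr, hball⟩ := Metric.isOpen_iff.1 h.isOpen x hx
  have hconst : ∀ y ∈ Metric.ball x r, μ y = μ x := fun y hy ↦
    (convex_ball x r).is_const_of_fderivWithin_eq_zero (𝕜 := ℝ)
      (fun z hz ↦ (hdiff z (hball hz)).differentiableWithinAt)
      (fun z hz ↦ by rw [fderivWithin_of_isOpen Metric.isOpen_ball hz, hzero z (hball hz)]) hy
      (Metric.mem_ball_self hr)
  refine ⟨r, hr, hball, fun y hy ↦ ⟨hconst y hy, ?_⟩⟩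
  have hd : ∀ z ∈ Metric.ball x r, DifferentiableAt ℝ N z ∧ DifferentiableAt ℝ F z :=
    fun z hz ↦ ⟨ContDiffOn.differentiableAt_of_isOpen hN h.isOpen (hball hz),
      h.differentiableAt (hball hz)⟩
  refine (convex_ball x r).is_const_of_fderivWithin_eq_zero (𝕜 := ℝ)
    (f := fun y ↦ N y + μ x • F y)
    (fun z hz ↦ ((hd z hz).1.fun_add ((hd z hz).2.fun_const_smul _)).differentiableWithinAt)
    (fun z hz ↦ ?_) hy (Metric.mem_ball_self hr)
  rw [fderivWithin_of_isOpen Metric.isOpen_ball hz]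
  ext1 v
  rw [fderiv_eq_sum_pd]
  refine Finset.sum_eq_zero fun i _ ↦ ?_
  rw [pd_add (hd z hz).1 ((hd z hz).2.fun_const_smul _),
    pd_smul (differentiableAt_const _) (hd z hz).2, hμ z (hball hz), hconst z hz, pd_const]
  simp

end LocalImmersion

/-! ### Self-adjoint endomorphisms of a Lorentzian space -/

/-- The matrix of the Lorentzian form in an orthonormal frame. -/
def minkowski : Matrix (Fin 4) (Fin 4) ℝ := Matrix.diagonal fun i ↦ if i = 3 then -1 else 1

/-- `G` is the Gram matrix of a Lorentzian form. -/
def IsLorentzian (G : Matrix (Fin 4) (Fin 4) ℝ) : Prop :=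
  ∃ P : Matrix (Fin 4) (Fin 4) ℝ, P.det ≠ 0 ∧ G = P * minkowski * P.transpose

theorem minkowski_form (x y : Fin 4 → ℝ) :
    x ⬝ᵥ minkowski.mulVec y = x 0 * y 0 + x 1 * y 1 + x 2 * y 2 - x 3 * y 3 := by
  simp [minkowski, Matrix.mulVec_diagonal, dotProduct, Fin.sum_univ_succ]
  ring

/-- Cauchy–Schwarz on the spatial parts gives `(x₃t₃)² ≤ |x|²|t|²`, and `|t|² < t₃²` because `t` is
timelike. -/
theorem minkowski_pos_of_orthogonal {t x : Fin 4 → ℝ} (ht : t ⬝ᵥ minkowski.mulVec t < 0)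
    (hx : x ⬝ᵥ minkowski.mulVec t = 0) (hx0 : x ≠ 0) : 0 < x ⬝ᵥ minkowski.mulVec x := by
  rw [minkowski_form] at *
  have hcs : (x 0 * t 0 + x 1 * t 1 + x 2 * t 2) ^ 2
      ≤ (x 0 ^ 2 + x 1 ^ 2 + x 2 ^ 2) * (t 0 ^ 2 + t 1 ^ 2 + t 2 ^ 2) := by
    nlinarith [sq_nonneg (x 0 * t 1 - x 1 * t 0), sq_nonneg (x 0 * t 2 - x 2 * t 0),
      sq_nonneg (x 1 * t 2 - x 2 * t 1)]
  have h1 : x 0 * t 0 + x 1 * t 1 + x 2 * t 2 = x 3 * t 3 := by linarith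
  rw [h1] at hcs
  have ht3 : 0 < t 3 ^ 2 := by nlinarith [sq_nonneg (t 0), sq_nonneg (t 1), sq_nonneg (t 2)]
  have ht' : t 0 ^ 2 + t 1 ^ 2 + t 2 ^ 2 < t 3 ^ 2 := by nlinarith
  set a := x 0 ^ 2 + x 1 ^ 2 + x 2 ^ 2 with ha
  have ha0 : 0 ≤ a := by positivity
  have key : x 3 ^ 2 < a := by
    rcases ha0.eq_or_lt with h0 | h0
    · exfalso
      apply hx0
      rw [← h0, zero_mul] at hcs
      have h3 : x 3 = 0 := by
        have : x 3 * t 3 = 0 := by nlinarith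
        rcases mul_eq_zero.1 this with h | h
        · exact h
        · rw [h] at ht3; simp at ht3
      have e0 : x 0 = 0 := by nlinarith [sq_nonneg (x 0), sq_nonneg (x 1), sq_nonneg (x 2)]
      have e1 : x 1 = 0 := by nlinarith [sq_nonneg (x 0), sq_nonneg (x 1), sq_nonneg (x 2)]
      have e2 : x 2 = 0 := by nlinarith [sq_nonneg (x 0), sq_nonneg (x 1), sq_nonneg (x 2)]
      ext i; fin_cases i <;> simpa
    · have : x 3 ^ 2 * t 3 ^ 2 < a * t 3 ^ 2 := by
        calc x 3 ^ 2 * t 3 ^ 2 = (x 3 * t 3) ^ 2 := by ring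
          _ ≤ _ := hcs
          _ < _ := mul_lt_mul_of_pos_left ht' h0
      exact lt_of_mul_lt_mul_right this ht3.le
  nlinarith

theorem dotProduct_mulVec_comm {n : Type*} [Fintype n] {k : Matrix n n ℝ} (hk : k.transpose = k)
    (x y : n → ℝ) : x ⬝ᵥ k.mulVec y = y ⬝ᵥ k.mulVec x := by
  rw [dotProduct_comm, Matrix.dotProduct_mulVec, ← Matrix.mulVec_transpose, hk]

namespace IsLorentzian

variable {G : Matrix (Fin 4) (Fin 4) ℝ}

theorem det_neg (hG : IsLorentzian G) : G.det < 0 := by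
  obtain ⟨P, hP, rfl⟩ := hG
  have : minkowski.det = -1 := by simp [minkowski, Fin.prod_univ_succ, Fin.ext_iff]
  rw [Matrix.det_mul, Matrix.det_mul, Matrix.det_transpose, this]
  have := mul_self_pos.2 hP
  linarith

theorem transpose_eq (hG : IsLorentzian G) : G.transpose = G := by
  obtain ⟨P, _, rfl⟩ := hG
  simp [Matrix.transpose_mul, minkowski, Matrix.mul_assoc]

theorem pos_of_orthogonal (hG : IsLorentzian G) {t x : Fin 4 → ℝ} (ht : t ⬝ᵥ G.mulVec t < 0)
    (hx : x ⬝ᵥ G.mulVec t = 0) (hx0 : x ≠ 0) : 0 < x ⬝ᵥ G.mulVec x := by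
  obtain ⟨P, hP, rfl⟩ := hG
  have key : ∀ x y, x ⬝ᵥ (P * minkowski * P.transpose).mulVec y
      = (P.transpose.mulVec x) ⬝ᵥ minkowski.mulVec (P.transpose.mulVec y) := by
    intro x y
    rw [← Matrix.mulVec_mulVec, ← Matrix.mulVec_mulVec, Matrix.dotProduct_mulVec,
      Matrix.mulVec_transpose P x]
  rw [key] at *
  refine minkowski_pos_of_orthogonal ht hx fun h0 ↦ hx0 ?_
  exact Matrix.eq_zero_of_mulVec_eq_zero (by rwa [Matrix.det_transpose]) h0

/-- The Riemannian metric obtained by reversing the sign of a Lorentzian metric on a timelike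
direction is positive definite. -/
theorem posDef_flip (hG : IsLorentzian G) {t : Fin 4 → ℝ} (ht : t ⬝ᵥ G.mulVec t < 0) :
    (G - (2 / (t ⬝ᵥ G.mulVec t)) • Matrix.vecMulVec (G.mulVec t) (G.mulVec t)).PosDef := by
  set q := t ⬝ᵥ G.mulVec t with hq
  refine Matrix.PosDef.of_dotProduct_mulVec_pos ?_ fun x hx0 ↦ ?_
  · rw [Matrix.IsHermitian, Matrix.conjTranspose_eq_transpose_of_trivial, Matrix.transpose_sub,
      Matrix.transpose_smul, Matrix.transpose_vecMulVec, hG.transpose_eq]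
  -- `α` is the coefficient of `x` along `t`. The flipped form is the spacelike square of `x - α t`
  -- plus `-α² q`, and `q < 0`.
  · set α := x ⬝ᵥ G.mulVec t / q with hα
    have hform : star x ⬝ᵥ (G - (2 / q) • Matrix.vecMulVec (G.mulVec t) (G.mulVec t)).mulVec x
        = (x - α • t) ⬝ᵥ G.mulVec (x - α • t) - α ^ 2 * q := by
      simp only [star_trivial, Matrix.sub_mulVec, Matrix.smul_mulVec, Matrix.vecMulVec_mulVec,
        Matrix.mulVec_sub, Matrix.mulVec_smul, dotProduct_sub, sub_dotProduct, smul_dotProduct,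
        dotProduct_smul, MulOpposite.smul_eq_mul_unop, smul_eq_mul, MulOpposite.unop_op,
        dotProduct_mulVec_comm hG.transpose_eq t x, ← hq, dotProduct_comm (G.mulVec t) x]
      rw [hα]
      ring
    rw [hform]
    have horth : (x - α • t) ⬝ᵥ G.mulVec t = 0 := by
      rw [sub_dotProduct, smul_dotProduct, ← hq, hα, smul_eq_mul, div_mul_cancel₀ _ ht.ne, sub_self]
    by_cases h0 : x - α • t = 0
    · rw [h0]
      have : α ≠ 0 := by
        intro h; rw [h] at h0; simp at h0; exact hx0 h0
      have := mul_self_pos.2 this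
      simp only [zero_dotProduct]
      nlinarith
    · have := hG.pos_of_orthogonal ht horth h0
      nlinarith [mul_self_nonneg α]

end IsLorentzian

open scoped MatrixOrder Matrix.Norms.L2Operator in
/-- A self-adjoint endomorphism for a positive definite form vanishes if its square has trace
zero. -/
theorem eq_zero_of_trace_sq_eq_zero {n : Type*} [Fintype n] [DecidableEq n]
    {P k : Matrix n n ℝ} (hP : P.PosDef) (hk : k.transpose = k)
    (htr : (P⁻¹ * k * (P⁻¹ * k)).trace = 0) : k = 0 := by
  -- With `P⁻¹ = Rᵀ R`, the trace becomes the squared Frobenius norm of the symmetric matrix `R k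
  -- Rᵀ`.
  obtain ⟨R, hR⟩ := CStarAlgebra.nonneg_iff_eq_star_mul_self.mp hP.inv.posSemidef.nonneg
  rw [Matrix.star_eq_conjTranspose, Matrix.conjTranspose_eq_transpose_of_trivial] at hR
  have hRdet : R.det ≠ 0 := by
    intro h0
    have h1 := hP.inv.det_pos
    rw [hR, Matrix.det_mul, h0, mul_zero] at h1
    exact lt_irrefl _ h1
  have hC : (R * k * R.transpose).transpose = R * k * R.transpose := by
    simp [Matrix.transpose_mul, hk, Matrix.mul_assoc]
  have h0 : ((R * k * R.transpose).conjTranspose * (R * k * R.transpose)).trace = 0 := by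
    rw [Matrix.conjTranspose_eq_transpose_of_trivial, hC, ← htr, hR]
    rw [show R.transpose * R * k * (R.transpose * R * k)
      = R.transpose * (R * k * R.transpose * R * k) by simp only [Matrix.mul_assoc],
      Matrix.trace_mul_comm R.transpose]
    simp only [Matrix.mul_assoc]
  rw [Matrix.trace_conjTranspose_mul_self_eq_zero_iff] at h0
  have h1 : R⁻¹ * (R * k * R.transpose) * (R.transpose)⁻¹ = k := by
    rw [Matrix.mul_assoc, Matrix.mul_nonsing_inv_cancel_right, Matrix.nonsing_inv_mul_cancel_left]
    · exact isUnit_iff_ne_zero.2 hRdet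
    · rw [Matrix.det_transpose]; exact isUnit_iff_ne_zero.2 hRdet
  rw [← h1, h0]; simp

/-- A symmetric matrix for which `t` is an eigendirection and whose square is traceless
vanishes. -/
theorem IsLorentzian.eq_zero_of_trace_sq {G k : Matrix (Fin 4) (Fin 4) ℝ} (hG : IsLorentzian G)
    (hk : k.transpose = k) {t : Fin 4 → ℝ} (ht : t ⬝ᵥ G.mulVec t < 0)
    (hkt : ∀ x, x ⬝ᵥ G.mulVec t = 0 → x ⬝ᵥ k.mulVec t = 0)
    (htr : (G⁻¹ * k * (G⁻¹ * k)).trace = 0) : k = 0 := by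
  have hdet := hG.det_neg.ne.isUnit
  have hP := hG.posDef_flip ht
  set u := G.mulVec t with hu
  set q := t ⬝ᵥ u with hq
  set B := G⁻¹ * k with hB
  -- By `hkt`, the functional `k t` vanishes on the kernel of `u`, hence is proportional to `u`.
  obtain ⟨c, hc⟩ : ∃ c : ℝ, k.mulVec t = c • u := by
    refine ⟨t ⬝ᵥ k.mulVec t / q, ?_⟩
    rw [← sub_eq_zero]
    refine dotProduct_eq_zero _ fun x ↦ ?_
    have h1 := hkt (x - (x ⬝ᵥ u / q) • t) (by
      rw [sub_dotProduct, smul_dotProduct, ← hq, smul_eq_mul, div_mul_cancel₀ _ ht.ne, sub_self])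
    rw [sub_dotProduct, smul_dotProduct, smul_eq_mul] at h1
    rw [dotProduct_comm, dotProduct_sub, dotProduct_smul, smul_eq_mul]
    linear_combination h1
  -- The reflection sending `t` to `-t` and fixing its orthogonal complement; `G * S` is the
  -- positive definite matrix of `posDef_flip`. It commutes with `B` because `t` and `u` are right
  -- and left eigenvectors of `B` for the same eigenvalue.
  set S : Matrix (Fin 4) (Fin 4) ℝ := 1 - (2 / q) • Matrix.vecMulVec t u with hS
  have hGS : G - (2 / q) • Matrix.vecMulVec u u = G * S := by
    rw [hS, Matrix.mul_sub, Matrix.mul_one, Matrix.mul_smul, Matrix.mul_vecMulVec]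
  have hSS : S * S = 1 := by
    have h1 : Matrix.vecMulVec t u * Matrix.vecMulVec t u = q • Matrix.vecMulVec t u := by
      rw [Matrix.vecMulVec_mul_vecMulVec, dotProduct_comm, ← hq, Matrix.vecMulVec_smul]
    simp only [hS, Matrix.mul_sub, Matrix.sub_mul, Matrix.smul_mul, Matrix.mul_smul, h1, smul_smul,
      Matrix.one_mul, Matrix.mul_one]
    rw [div_mul_cancel₀ _ ht.ne]
    module
  have hBt : B.mulVec t = c • t := by
    rw [hB, ← Matrix.mulVec_mulVec, hc, Matrix.mulVec_smul, hu, Matrix.mulVec_mulVec,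
      Matrix.nonsing_inv_mul _ hdet, Matrix.one_mulVec]
  have huB : Matrix.vecMul u B = c • u := by
    rw [hu, ← Matrix.vecMul_transpose, hG.transpose_eq, Matrix.vecMul_vecMul, hB,
      Matrix.mul_nonsing_inv_cancel_left _ _ hdet, ← Matrix.mulVec_transpose, hk, hc, hu,
      ← Matrix.mulVec_transpose, hG.transpose_eq]
  have hSB : S * B = B * S := by
    rw [hS, Matrix.sub_mul, Matrix.mul_sub, Matrix.smul_mul, Matrix.mul_smul,
      Matrix.mul_vecMulVec, Matrix.vecMulVec_mul, hBt, huB, Matrix.vecMulVec_smul,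
      Matrix.smul_vecMulVec, Matrix.one_mul, Matrix.mul_one]
  rw [hGS] at hP
  refine eq_zero_of_trace_sq_eq_zero hP hk ?_
  have hinv : (G * S)⁻¹ * k = S * B := by
    rw [Matrix.mul_inv_rev, Matrix.inv_eq_left_inv hSS, hB, Matrix.mul_assoc]
  rw [hinv, show S * B * (S * B) = B * B by
    rw [hSB, Matrix.mul_assoc, ← hSB, ← Matrix.mul_assoc S, hSS, Matrix.one_mul]]
  exact htr

/-- The trace identity says precisely that the traceless part `h - (τ/4) G` satisfies the hypothesis
of `eq_zero_of_trace_sq`. -/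
theorem IsLorentzian.eq_smul_of_trace {G h : Matrix (Fin 4) (Fin 4) ℝ} (hG : IsLorentzian G)
    (hh : h.transpose = h) {t : Fin 4 → ℝ} (ht : t ⬝ᵥ G.mulVec t < 0)
    (hht : ∀ x, x ⬝ᵥ G.mulVec t = 0 → x ⬝ᵥ h.mulVec t = 0)
    (htr : 4 * (G⁻¹ * h * (G⁻¹ * h)).trace = (G⁻¹ * h).trace ^ 2) :
    h = ((G⁻¹ * h).trace / 4) • G := by
  set τ := (G⁻¹ * h).trace
  have hdet := hG.det_neg.ne.isUnit
  rw [← sub_eq_zero]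
  refine hG.eq_zero_of_trace_sq ?_ ht (fun x hx ↦ ?_) ?_
  · rw [Matrix.transpose_sub, Matrix.transpose_smul, hh, hG.transpose_eq]
  · rw [Matrix.sub_mulVec, Matrix.smul_mulVec, dotProduct_sub, dotProduct_smul, hx, hht x hx]
    simp
  · have : G⁻¹ * (h - (τ / 4) • G) = G⁻¹ * h - (τ / 4) • 1 := by
      rw [Matrix.mul_sub, Matrix.mul_smul, Matrix.nonsing_inv_mul _ hdet]
    rw [this, Matrix.mul_sub, Matrix.sub_mul, Matrix.trace_sub, Matrix.trace_sub]
    simp only [Matrix.smul_mul, Matrix.mul_smul, Matrix.one_mul, Matrix.mul_one, Matrix.trace_sub,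
      Matrix.trace_smul, Matrix.trace_one, smul_eq_mul]
    simp only [Fintype.card_fin]
    change _ - τ / 4 * τ - τ / 4 * (τ - τ / 4 * ((4 : ℕ) : ℝ)) = 0
    push_cast
    linarith

variable {M : Type*} [TopologicalSpace M] [ChartedSpace E4 M]

/-! ### Transfer between the manifold and a chart -/

/-- The part of the chart domain at `p` that corresponds to `U`. -/
def chartDomain (U : Set M) (p : M) : Set E4 :=
  (extChartAt (𝓡 4) p).target ∩ (extChartAt (𝓡 4) p).symm ⁻¹' U

theorem isOpen_chartDomain {U : Set M} (hU : IsOpen U) (p : M) : IsOpen (chartDomain U p) :=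
  (continuousOn_extChartAt_symm p).isOpen_inter_preimage (isOpen_extChartAt_target p) hU

theorem extChartAt_mem_chartDomain {U : Set M} {p : M} (hp : p ∈ U) :
    extChartAt (𝓡 4) p p ∈ chartDomain U p :=
  ⟨mem_extChartAt_target p, by simpa using hp⟩

/-- The coordinate frame of the chart at `p`. -/
def frame (p : M) (x : E4) (i : Fin 4) : TangentSpace (𝓡 4) ((extChartAt (𝓡 4) p).symm x) :=
  mfderiv 𝓘(ℝ, E4) (𝓡 4) (extChartAt (𝓡 4) p).symm x (e i)

theorem sum_smul_frame {p : M} {x : E4} (w : E4) : ∑ i, w i • frame p x i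
    = mfderiv 𝓘(ℝ, E4) (𝓡 4) (extChartAt (𝓡 4) p).symm x w := by
  have hv : w = ∑ i, w i • e i := by
    ext k
    simp [e, Finset.sum_apply, Pi.single_apply]
  let D : E4 →L[ℝ] TangentSpace (𝓡 4) ((extChartAt (𝓡 4) p).symm x) :=
    mfderiv 𝓘(ℝ, E4) (𝓡 4) (extChartAt (𝓡 4) p).symm x
  have h1 : D w = ∑ i, w i • D (e i) := by
    conv_lhs => rw [hv]
    rw [map_sum]
    simp only [map_smul]
  exact h1.symm

theorem ContMDiffOn.mdifferentiableAt_of_isOpen {f : M → E5} {U : Set M}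
    (hf : ContMDiffOn (𝓡 4) 𝓘(ℝ, E5) ∞ f U) (hU : IsOpen U) {p : M} (hp : p ∈ U) :
    MDifferentiableAt (𝓡 4) 𝓘(ℝ, E5) f p :=
  (hf.contMDiffAt (hU.mem_nhds hp)).mdifferentiableAt (by simp)

variable [IsManifold (𝓡 4) ∞ M]

theorem contMDiffOn_coordMap {f : M → E5} {U : Set M} (hf : ContMDiffOn (𝓡 4) 𝓘(ℝ, E5) ∞ f U)
    (p : M) : ContDiffOn ℝ ∞ (coordMap f p) (chartDomain U p) := by
  rw [← contMDiffOn_iff_contDiffOn]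
  exact hf.comp ((contMDiffOn_extChartAt_symm p).mono Set.inter_subset_left) fun x hx ↦ hx.2

theorem mdifferentiableAt_extChartAt_symm {p : M} {x : E4} (hx : x ∈ (extChartAt (𝓡 4) p).target) :
    MDifferentiableAt 𝓘(ℝ, E4) (𝓡 4) (extChartAt (𝓡 4) p).symm x := by
  have := mdifferentiableWithinAt_extChartAt_symm (I := 𝓡 4) hx
  rwa [ModelWithCorners.range_eq_univ, mdifferentiableWithinAt_univ] at this

theorem isInvertible_mfderiv_extChartAt_symm {p : M} {x : E4}
    (hx : x ∈ (extChartAt (𝓡 4) p).target) :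
    (mfderiv 𝓘(ℝ, E4) (𝓡 4) (extChartAt (𝓡 4) p).symm x).IsInvertible := by
  have := isInvertible_mfderivWithin_extChartAt_symm (I := 𝓡 4) hx
  rwa [ModelWithCorners.range_eq_univ, mfderivWithin_univ] at this

theorem exists_eq_sum_frame {p : M} {x : E4} (hx : x ∈ (extChartAt (𝓡 4) p).target)
    (X : TangentSpace (𝓡 4) ((extChartAt (𝓡 4) p).symm x)) :
    ∃ c : Fin 4 → ℝ, X = ∑ i, c i • frame p x i := by
  obtain ⟨w, hw⟩ := (isInvertible_mfderiv_extChartAt_symm hx).bijective.2 X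
  exact ⟨fun i ↦ (show E4 from w) i, by rw [← hw]; exact (sum_smul_frame (show E4 from w)).symm⟩

theorem linearIndependent_frame {p : M} {x : E4} (hx : x ∈ (extChartAt (𝓡 4) p).target) :
    LinearIndependent ℝ (frame p x) := by
  refine Fintype.linearIndependent_iff.2 fun c hc i ↦ ?_
  have h1 := sum_smul_frame (p := p) (x := x) (WithLp.toLp 2 c)
  have h2 : ∑ i, (WithLp.toLp 2 c : E4) i • frame p x i = 0 := hc
  rw [h2] at h1
  have h3 := (isInvertible_mfderiv_extChartAt_symm hx).bijective.1 (h1.symm.trans (map_zero _).symm)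
  exact congrFun (congrArg WithLp.ofLp h3) i

/-- The matrix `P` consists of the coordinates of `v` in the orthonormal basis; independence of `v`
makes it invertible. -/
theorem isLorentzian_of_basis {V : Type*} [AddCommGroup V] [Module ℝ V] [TopologicalSpace V]
    (B : V →L[ℝ] V →L[ℝ] ℝ) (b : Module.Basis (Fin 4) ℝ V)
    (hb : ∀ i j, B (b i) (b j) = if i = j then (if i = 3 then -1 else 1) else 0)
    {v : Fin 4 → V} (hv : LinearIndependent ℝ v) :
    IsLorentzian (Matrix.of fun i j ↦ B (v i) (v j)) := by
  refine ⟨Matrix.of fun i k ↦ b.repr (v i) k, fun h0 ↦ ?_, ?_⟩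
  · obtain ⟨c, hc0, hc⟩ := Matrix.exists_vecMul_eq_zero_iff.2 h0
    refine hc0 (funext (Fintype.linearIndependent_iff.1 hv c (b.repr.injective ?_)))
    ext k
    have := congrFun hc k
    simpa [Matrix.vecMul, dotProduct, Finsupp.finsetSum_apply] using this
  · ext i j
    rw [Matrix.of_apply]
    conv_lhs => rw [← b.sum_repr (v i), ← b.sum_repr (v j)]
    rw [minkowski, Matrix.mul_apply]
    simp only [Matrix.mul_diagonal, Matrix.transpose_apply, Matrix.of_apply]
    simp [-Module.Basis.sum_repr, Fin.sum_univ_succ, hb, Fin.ext_iff, smul_apply]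

theorem isLorentzian_coordMetric (g : LorentzMetric M) {p : M} {x : E4}
    (hx : x ∈ (extChartAt (𝓡 4) p).target) : IsLorentzian (coordMetric g p x) := by
  obtain ⟨b, hb⟩ := g.signature ((extChartAt (𝓡 4) p).symm x)
  exact isLorentzian_of_basis (g.val _) b hb (linearIndependent_frame hx)

/-! ### Isometric immersions of the manifold, read in charts -/

/-- The differential of a map to `E5`. -/
def differential (f : M → E5) (p : M) : TangentSpace (𝓡 4) p →L[ℝ] E5 :=
  mfderiv (𝓡 4) 𝓘(ℝ, E5) f p

/-- `f` restricts to an isometric immersion of the open set `U`. -/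
structure IsIsometricImmersionOn (g : LorentzMetric M) (ε : ℝ) (f : M → E5) (U : Set M) :
    Prop where
  sign : ε = 1 ∨ ε = -1
  isOpen : IsOpen U
  contMDiffOn : ContMDiffOn (𝓡 4) 𝓘(ℝ, E5) ∞ f U
  isometric : ∀ p ∈ U, ∀ X Y : TangentSpace (𝓡 4) p,
    eta ε (mfderiv (𝓡 4) 𝓘(ℝ, E5) f p X) (mfderiv (𝓡 4) 𝓘(ℝ, E5) f p Y) = g.val p X Y

/-- `ξ` is a smooth unit normal field of `f` on `U`. -/
structure IsUnitNormalFieldOn (ε : ℝ) (f ξ : M → E5) (U : Set M) : Prop where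
  contMDiffOn : ContMDiffOn (𝓡 4) 𝓘(ℝ, E5) ∞ ξ U
  isUnitNormal : ∀ p ∈ U, IsUnitNormal ε f p (ξ p)

theorem pd_coordMap {f : M → E5} {p : M} {x : E4} (hx : x ∈ (extChartAt (𝓡 4) p).target)
    (hf : MDifferentiableAt (𝓡 4) 𝓘(ℝ, E5) f ((extChartAt (𝓡 4) p).symm x)) (i : Fin 4) :
    pd i (coordMap f p) x
      = differential f ((extChartAt (𝓡 4) p).symm x) (frame p x i) := by
  rw [pd, ← mfderiv_eq_fderiv, coordMap, mfderiv_comp x hf (mdifferentiableAt_extChartAt_symm hx)]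
  rfl

namespace IsIsometricImmersionOn

variable {g : LorentzMetric M} {ε : ℝ} {f ξ : M → E5} {U W : Set M}

theorem mono (h : IsIsometricImmersionOn g ε f U) (hW : IsOpen W) (hWU : W ⊆ U) :
    IsIsometricImmersionOn g ε f W :=
  ⟨h.sign, hW, h.contMDiffOn.mono hWU, fun p hp ↦ h.isometric p (hWU hp)⟩

theorem mdifferentiableAt (h : IsIsometricImmersionOn g ε f U) {p : M} (hp : p ∈ U) :
    MDifferentiableAt (𝓡 4) 𝓘(ℝ, E5) f p :=
  ContMDiffOn.mdifferentiableAt_of_isOpen h.contMDiffOn h.isOpen hp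

theorem pd_coordMap_eq (h : IsIsometricImmersionOn g ε f U) {p : M} {x : E4}
    (hx : x ∈ chartDomain U p) (i : Fin 4) : pd i (coordMap f p) x
      = differential f ((extChartAt (𝓡 4) p).symm x) (frame p x i) :=
  pd_coordMap hx.1 (h.mdifferentiableAt hx.2) i

theorem localImmersion (h : IsIsometricImmersionOn g ε f U) (p : M) :
    LocalImmersion ε (chartDomain U p) (coordMap f p) (coordMetric g p) where
  sign := h.sign
  isOpen := isOpen_chartDomain h.isOpen p
  contDiffOn := contMDiffOn_coordMap h.contMDiffOn p
  gram_eq x hx := by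
    ext i j
    simp only [gram, Matrix.of_apply, h.pd_coordMap_eq hx]
    exact (h.isometric _ hx.2 _ _).symm
  det_neg x hx := (isLorentzian_coordMetric g hx.1).det_neg

theorem isUnitNormal_iff (h : IsIsometricImmersionOn g ε f U) {p : M} {x : E4}
    (hx : x ∈ chartDomain U p) (v : E5) : IsUnitNormal ε f ((extChartAt (𝓡 4) p).symm x) v ↔
      eta ε v v = ε ∧ ∀ i, eta ε (pd i (coordMap f p) x) v = 0 := by
  refine and_congr_right fun _ ↦ ⟨fun h1 i ↦ ?_, fun h1 X ↦ ?_⟩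
  · rw [h.pd_coordMap_eq hx]; exact h1 _
  · obtain ⟨c, rfl⟩ := exists_eq_sum_frame hx.1 X
    change eta ε (differential f _ (∑ i, c i • frame p x i)) v = 0
    rw [map_sum, eta_sum_left]
    refine Finset.sum_eq_zero fun i _ ↦ ?_
    rw [map_smul, eta_smul_left, ← h.pd_coordMap_eq hx, h1, mul_zero]

theorem localNormal (h : IsIsometricImmersionOn g ε f U) (hξ : IsUnitNormalFieldOn ε f ξ U)
    (p : M) : LocalNormal ε (chartDomain U p) (coordMap f p) (coordMap ξ p) where
  contDiffOn := contMDiffOn_coordMap hξ.contMDiffOn p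
  unit _ hx := (hξ.isUnitNormal _ hx.2).1
  orth _ hx := ((h.isUnitNormal_iff hx _).1 (hξ.isUnitNormal _ hx.2)).2

theorem exists_isUnitNormalFieldOn (h : IsIsometricImmersionOn g ε f U) (p : M) :
    ∃ ξ, IsUnitNormalFieldOn ε f ξ ((extChartAt (𝓡 4) p).source ∩ U) := by
  obtain ⟨N, hN⟩ := (h.localImmersion p).exists_normal
  have hmem : ∀ q ∈ (extChartAt (𝓡 4) p).source ∩ U, extChartAt (𝓡 4) p q ∈ chartDomain U p :=
    fun q hq ↦ ⟨(extChartAt (𝓡 4) p).map_source hq.1, by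
      simpa only [Set.mem_preimage, (extChartAt (𝓡 4) p).left_inv hq.1] using hq.2⟩
  refine ⟨N ∘ extChartAt (𝓡 4) p, ?_, fun q hq ↦ ?_⟩
  · refine hN.contDiffOn.contMDiffOn.comp (t := chartDomain U p) ?_ hmem
    refine (contMDiffOn_extChartAt (x := p)).mono fun q hq ↦ ?_
    rw [← extChartAt_source (𝓡 4)]; exact hq.1
  · have h1 := (h.isUnitNormal_iff (hmem q hq) (N (extChartAt (𝓡 4) p q))).2
      ⟨hN.unit _ (hmem q hq), hN.orth _ (hmem q hq)⟩
    rwa [(extChartAt (𝓡 4) p).left_inv hq.1] at h1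

/-- The Weingarten form of the umbilicity condition. -/
theorem hasShapeAt_iff (h : IsIsometricImmersionOn g ε f U) (hξ : IsUnitNormalFieldOn ε f ξ U)
    {p : M} (hp : p ∈ U) (μ : ℝ) : HasShapeAt g ε f p (ξ p) μ ↔
      ∀ i, pd i (coordMap ξ p) (extChartAt (𝓡 4) p p)
        = -μ • pd i (coordMap f p) (extChartAt (𝓡 4) p p) := by
  rw [HasShapeAt, and_iff_right (hξ.isUnitNormal p hp),
    ← (h.localImmersion p).shape_iff (h.localNormal hξ p) (extChartAt_mem_chartDomain hp)]
  have : coordMap ξ p (extChartAt (𝓡 4) p p) = ξ p := by simp [coordMap]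
  rw [this]
  rfl

theorem hasShapeAt_iff_mfderiv (h : IsIsometricImmersionOn g ε f U)
    (hξ : IsUnitNormalFieldOn ε f ξ U) {p q : M} {x : E4} (hx : x ∈ chartDomain U p)
    (hq : (extChartAt (𝓡 4) p).symm x = q) (μ : ℝ) :
    (∀ i, pd i (coordMap ξ p) x = -μ • pd i (coordMap f p) x) ↔
      differential ξ q = -μ • differential f q := by
  subst hq
  have h1 := fun i ↦ pd_coordMap hx.1
    (ContMDiffOn.mdifferentiableAt_of_isOpen hξ.contMDiffOn h.isOpen hx.2) i
  simp only [h1, h.pd_coordMap_eq hx]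
  refine ⟨fun h2 ↦ ?_, fun h2 i ↦ by rw [h2]; rfl⟩
  ext1 X
  obtain ⟨c, rfl⟩ := exists_eq_sum_frame hx.1 X
  simp only [map_sum, map_smul, h2, smul_apply]

/-- `HasShapeAt` at a point refers to that point's own preferred chart. The equation `dξ = -μ df` is
chart-free and carries the condition to the single chart at `p`, where it can be differentiated. -/
theorem hasShapeAt_iff_of_chart (h : IsIsometricImmersionOn g ε f U)
    (hξ : IsUnitNormalFieldOn ε f ξ U) {p : M} {x : E4} (hx : x ∈ chartDomain U p) (μ : ℝ) :
    HasShapeAt g ε f ((extChartAt (𝓡 4) p).symm x) (ξ ((extChartAt (𝓡 4) p).symm x)) μ ↔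
      ∀ i, pd i (coordMap ξ p) x = -μ • pd i (coordMap f p) x := by
  rw [h.hasShapeAt_iff hξ hx.2, h.hasShapeAt_iff_mfderiv hξ hx rfl,
    h.hasShapeAt_iff_mfderiv hξ (extChartAt_mem_chartDomain hx.2) (extChartAt_to_inv _)]

end IsIsometricImmersionOn

/-! ### Causal-type preserving ideal embeddings -/

/-- The tangent vector at `q` with components `c` in the chart at `p`. -/
def chartVector {p q : M} {x : E4} (hq : (extChartAt (𝓡 4) p).symm x = q) (c : Fin 4 → ℝ) :
    TangentSpace (𝓡 4) q :=
  hq ▸ ∑ i, c i • frame p x i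

theorem exists_eq_chartVector {p q : M} {x : E4} (hx : x ∈ (extChartAt (𝓡 4) p).target)
    (hq : (extChartAt (𝓡 4) p).symm x = q) (X : TangentSpace (𝓡 4) q) :
    ∃ c, X = chartVector hq c := by
  subst hq
  exact exists_eq_sum_frame hx X

theorem val_chartVector (g : LorentzMetric M) {p q : M} {x : E4}
    (hq : (extChartAt (𝓡 4) p).symm x = q) (c d : Fin 4 → ℝ) :
    g.val q (chartVector hq c) (chartVector hq d) = c ⬝ᵥ (coordMetric g p x).mulVec d := by
  subst hq
  have h1 : ∀ i j, g.val _ (frame p x i) (frame p x j) = coordMetric g p x i j := fun i j ↦ rfl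
  simp only [chartVector, map_sum, map_smul, sum_apply, smul_apply, smul_eq_mul,
    h1, dotProduct, Matrix.mulVec]
  simp only [Finset.mul_sum]
  rw [Finset.sum_comm]
  exact Finset.sum_congr rfl fun i _ ↦ Finset.sum_congr rfl fun j _ ↦ by ring

namespace IsIsometricImmersionOn

variable {g : LorentzMetric M} {ε : ℝ} {f ξ : M → E5} {U : Set M}

theorem eta_differential_chartVector (h : IsIsometricImmersionOn g ε f U)
    (hξ : IsUnitNormalFieldOn ε f ξ U) {p q : M} {x : E4} (hx : x ∈ chartDomain U p)
    (hq : (extChartAt (𝓡 4) p).symm x = q) (c d : Fin 4 → ℝ) :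
    eta ε (differential ξ q (chartVector hq c)) (differential f q (chartVector hq d))
      = -(c ⬝ᵥ (Matrix.of fun i j ↦ eta ε (pd i (pd j (coordMap f p)) x)
          (coordMap ξ p x)).mulVec d) := by
  subst hq
  have h1 := fun i ↦ pd_coordMap hx.1
    (ContMDiffOn.mdifferentiableAt_of_isOpen hξ.contMDiffOn h.isOpen hx.2) i
  simp only [chartVector, map_sum, map_smul, ← h1, ← h.pd_coordMap_eq hx, eta_sum_left,
    eta_sum_right, eta_smul_left, eta_smul_right,
    (h.localImmersion p).eta_pd_normal (h.localNormal hξ p) hx, dotProduct, Matrix.mulVec,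
    Matrix.of_apply, ← Finset.sum_neg_distrib, Finset.mul_sum]
  rw [Finset.sum_comm]
  refine Finset.sum_congr rfl fun i _ ↦ Finset.sum_congr rfl fun j _ ↦ ?_
  ring

theorem secondFund_eq (h : IsIsometricImmersionOn g ε f U)
    (hξ : IsUnitNormalFieldOn ε f ξ U) {p : M} (hp : p ∈ U) (i j : Fin 4) :
    secondFund g f p i j = (ε * eta ε (pd i (pd j (coordMap f p)) (extChartAt (𝓡 4) p p))
      (coordMap ξ p (extChartAt (𝓡 4) p p))) • ξ p := by
  have h1 := (h.localImmersion p).gauss_formula (h.localNormal hξ p)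
    (extChartAt_mem_chartDomain hp) i j
  have h2 : coordMap ξ p (extChartAt (𝓡 4) p p) = ξ p := by simp [coordMap]
  rw [← h2]
  exact sub_eq_iff_eq_add'.2 h1

theorem riemann_eq (h : IsIsometricImmersionOn g ε f U)
    (hξ : IsUnitNormalFieldOn ε f ξ U) {p : M} (hp : p ∈ U) (a b c d : Fin 4) :
    riemann g p a b c d = ε *
      (eta ε (pd a (pd c (coordMap f p)) (extChartAt (𝓡 4) p p))
          (coordMap ξ p (extChartAt (𝓡 4) p p))
        * eta ε (pd b (pd d (coordMap f p)) (extChartAt (𝓡 4) p p))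
          (coordMap ξ p (extChartAt (𝓡 4) p p))
        - eta ε (pd a (pd d (coordMap f p)) (extChartAt (𝓡 4) p p))
          (coordMap ξ p (extChartAt (𝓡 4) p p))
        * eta ε (pd b (pd c (coordMap f p)) (extChartAt (𝓡 4) p p))
          (coordMap ξ p (extChartAt (𝓡 4) p p))) :=
  (h.localImmersion p).gauss_equation (h.localNormal hξ p) (extChartAt_mem_chartDomain hp) a b c d

end IsIsometricImmersionOn

/-- The full contraction of the right side of the Gauss equation, turning the scalar curvature into
traces. -/
theorem sum_mul_mul_eq_trace {A k : Matrix (Fin 4) (Fin 4) ℝ} (hk : k.transpose = k) :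
    ∑ a, ∑ b, ∑ c, ∑ d, A a c * A b d * (k a c * k b d - k a d * k b c)
      = (A * k).trace ^ 2 - (A * k * (A * k)).trace := by
  have hk' : ∀ i j, k i j = k j i := fun i j ↦ by conv_lhs => rw [← hk, Matrix.transpose_apply]
  have h1 : (A * k).trace = ∑ a, ∑ c, A a c * k a c := by
    simp only [Matrix.trace, Matrix.diag, Matrix.mul_apply]
    exact Finset.sum_congr rfl fun a _ ↦ Finset.sum_congr rfl fun c _ ↦ by rw [hk']
  have h2 : (A * k * (A * k)).trace = ∑ a, ∑ b, ∑ c, ∑ d, A a c * A b d * (k a d * k b c) := by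
    simp only [Matrix.trace, Matrix.diag, Matrix.mul_apply, Finset.sum_mul, Finset.mul_sum]
    refine Finset.sum_congr rfl fun a _ ↦ Finset.sum_congr rfl fun b _ ↦ ?_
    rw [Finset.sum_comm]
    refine Finset.sum_congr rfl fun c _ ↦ Finset.sum_congr rfl fun d _ ↦ ?_
    rw [hk' c b, hk' d a]
    ring
  rw [h1, h2, sq, Finset.sum_mul_sum, ← Finset.sum_sub_distrib]
  refine Finset.sum_congr rfl fun a _ ↦ ?_
  rw [← Finset.sum_sub_distrib]
  refine Finset.sum_congr rfl fun b _ ↦ ?_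
  rw [Finset.sum_mul_sum, ← Finset.sum_sub_distrib]
  refine Finset.sum_congr rfl fun c _ ↦ ?_
  rw [← Finset.sum_sub_distrib]
  exact Finset.sum_congr rfl fun d _ ↦ by ring

theorem isUmbilicalAt_of_isIdealZeroAt {g : LorentzMetric M} {T : ∀ p : M, TangentSpace (𝓡 4) p}
    {ε : ℝ} {f : M → E5} {U : Set M} (h : IsIsometricImmersionOn g ε f U) {p : M} (hp : p ∈ U)
    (hT : g.val p (T p) (T p) < 0) (hc : IsCausalTypePreservingAt g T ε f p)
    (hi : IsIdealZeroAt g ε f p) : IsUmbilicalAt g ε f p := by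
  obtain ⟨ξ, hξ⟩ := h.exists_isUnitNormalFieldOn p
  have hW : IsOpen ((extChartAt (𝓡 4) p).source ∩ U) := (isOpen_extChartAt_source p).inter h.isOpen
  have hpW : p ∈ (extChartAt (𝓡 4) p).source ∩ U := ⟨mem_extChartAt_source p, hp⟩
  replace h := h.mono hW Set.inter_subset_right
  set W := (extChartAt (𝓡 4) p).source ∩ U
  set x := extChartAt (𝓡 4) p p with hx
  have hxW : x ∈ chartDomain W p := extChartAt_mem_chartDomain hpW
  have hq : (extChartAt (𝓡 4) p).symm x = p := extChartAt_to_inv p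
  set k : Matrix (Fin 4) (Fin 4) ℝ :=
    Matrix.of fun i j ↦ eta ε (pd i (pd j (coordMap f p)) x) (coordMap ξ p x) with hk
  have hksymm : k.transpose = k := by
    ext i j
    change eta ε (pd j (pd i (coordMap f p)) x) _ = eta ε (pd i (pd j (coordMap f p)) x) _
    rw [pd_comm (h.localImmersion p).isOpen (h.localImmersion p).contDiffOn hxW]
  have hG : IsLorentzian (metricAt g p) := isLorentzian_coordMetric g hxW.1
  obtain ⟨t, ht⟩ := exists_eq_chartVector hxW.1 hq (T p)
  have hGt : ∀ c d, g.val p (chartVector hq c) (chartVector hq d)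
      = c ⬝ᵥ (metricAt g p).mulVec d := fun c d ↦ val_chartVector g hq c d
  have hkt : ∀ c d, eta ε (differential ξ p (chartVector hq c))
      (differential f p (chartVector hq d)) = -(c ⬝ᵥ k.mulVec d) :=
    fun c d ↦ h.eta_differential_chartVector hξ hxW hq c d
  have hiso : ∀ X Y, eta ε (differential f p X) (differential f p Y) = g.val p X Y :=
    h.isometric p hpW
  have hcp := hc ξ (hξ.contMDiffOn.contMDiffAt (hW.mem_nhds hpW))
    (Filter.eventually_of_mem (hW.mem_nhds hpW) hξ.isUnitNormal)
  -- Both forms of causal-type preservation amount to `k(X, T) = 0` for `X ⊥ T`. For `ε = 1` the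
  -- derivative of `ξ` along `X` is paired with `T`; for `ε = -1` the derivative along `T` is paired
  -- with `X`, and `k` is symmetric.
  have horth : ∀ c, c ⬝ᵥ (metricAt g p).mulVec t = 0 → c ⬝ᵥ k.mulVec t = 0 := by
    intro c hct
    have hXT : g.val p (chartVector hq c) (T p) = 0 := by rw [ht, hGt, hct]
    rcases h.sign with hε | hε
    · obtain ⟨Y, hY, hXY⟩ := hcp.1 hε _ hXT
      have hXY' : differential ξ p (chartVector hq c) = differential f p Y := hXY
      have h1 := hkt c t
      rw [hXY', ← ht, hiso, hY] at h1
      linarith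
    · obtain ⟨r, hr⟩ := hcp.2 hε
      have hr' : differential ξ p (T p) = differential f p (r • T p) := hr
      have h1 := hkt t c
      rw [← ht, hr', map_smul, eta_smul_left, hiso, g.symm, hXT, mul_zero] at h1
      rw [dotProduct_mulVec_comm hksymm]
      linarith
  set A := (metricAt g p)⁻¹ with hA
  have hmean : meanCurvature g f p = (ε * (A * k).trace) • ξ p := by
    have hsf : ∀ i j, secondFund g f p i j = (ε * k i j) • ξ p := h.secondFund_eq hξ hpW
    simp only [meanCurvature, hsf, smul_smul, ← Finset.sum_smul, Matrix.trace, Matrix.diag,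
      Matrix.mul_apply, Finset.mul_sum]
    congr 1
    refine Finset.sum_congr rfl fun i _ ↦ Finset.sum_congr rfl fun j _ ↦ ?_
    rw [show k i j = k j i by conv_lhs => rw [← hksymm, Matrix.transpose_apply]]
    ring
  have hscal : scalarCurvature g p
      = (1 / 2) * (ε * ((A * k).trace ^ 2 - (A * k * (A * k)).trace)) := by
    rw [← sum_mul_mul_eq_trace hksymm, scalarCurvature]
    simp only [Finset.mul_sum]
    refine Finset.sum_congr rfl fun a _ ↦ Finset.sum_congr rfl fun b _ ↦
      Finset.sum_congr rfl fun c _ ↦ Finset.sum_congr rfl fun d _ ↦ ?_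
    rw [h.riemann_eq hξ hpW]
    simp only [hk, Matrix.of_apply]
    ring
  have hunit : eta ε (ξ p) (ξ p) = ε := (hξ.isUnitNormal p hpW).1
  -- The ideal condition is `ε τ² = (4/3) ε (τ² - tr (A k)²)`; `ε² = 1` removes the sign.
  have htr : 4 * (A * k * (A * k)).trace = (A * k).trace ^ 2 := by
    have h1 := hi
    rw [IsIdealZeroAt, chenLambdaZero, hmean, hscal, eta_smul_left, eta_smul_right, hunit] at h1
    have h2 := sq_eq_one_of h.sign
    linear_combination (3 * ε) * h1
      + (-4 * (A * k * (A * k)).trace + (A * k).trace ^ 2 * (1 - 3 * ε ^ 2)) * h2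
  have hfin := hG.eq_smul_of_trace hksymm (t := t) (by rw [← hGt, ← ht]; exact hT) horth htr
  refine ⟨ξ p, (A * k).trace / 4, hξ.isUnitNormal p hpW, fun i j ↦ ?_⟩
  rw [h.secondFund_eq hξ hpW]
  have := congrFun (congrFun hfin i) j
  rw [Matrix.smul_apply, smul_eq_mul] at this
  rw [← this]
  rfl

/-! ### Umbilical embeddings -/

theorem HasShapeAt.neg {g : LorentzMetric M} {ε : ℝ} {f : M → E5} {p : M} {ξ : E5} {μ : ℝ}
    (h : HasShapeAt g ε f p ξ μ) : HasShapeAt g ε f p (-ξ) (-μ) := by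
  refine ⟨⟨?_, fun X ↦ ?_⟩, fun i j ↦ ?_⟩
  · rw [eta_neg_left, eta_neg_right, neg_neg]; exact h.1.1
  · have h0 : eta ε (differential f p X) ξ = 0 := h.1.2 X
    change eta ε (differential f p X) (-ξ) = 0
    rw [eta_neg_right, h0, neg_zero]
  · rw [h.2 i j, smul_neg, ← neg_smul]
    ring_nf

namespace IsIsometricImmersionOn

variable {g : LorentzMetric M} {ε : ℝ} {f ξ : M → E5} {U : Set M}

theorem isUnitNormal_eq_or_neg (h : IsIsometricImmersionOn g ε f U) {p : M} (hp : p ∈ U)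
    {v w : E5} (hv : IsUnitNormal ε f p v) (hw : IsUnitNormal ε f p w) : v = w ∨ v = -w := by
  have hx := extChartAt_mem_chartDomain hp
  have hcoord := h.isUnitNormal_iff hx
  rw [extChartAt_to_inv] at hcoord
  rw [hcoord] at hv hw
  have h1 := eq_smul_of_eta_eq_zero h.sign ((h.localImmersion p).gram_det_neg hx).ne hw.2 hw.1 hv.2
  set c := ε * eta ε v w
  have hε0 : ε ≠ 0 := by rcases h.sign with h | h <;> rw [h] <;> norm_num
  have h2 := hv.1
  rw [h1, eta_smul_left, eta_smul_right, hw.1] at h2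
  have h3 : (c - 1) * (c + 1) = 0 := by
    apply mul_right_cancel₀ hε0
    linear_combination h2
  rcases mul_eq_zero.1 h3 with h4 | h4
  · left; rw [h1, sub_eq_zero.1 h4, one_smul]
  · right; rw [h1, eq_neg_of_add_eq_zero_left h4, neg_one_smul]

/-- Two different factors would force the metric at `p` to vanish, against its negative determinant.
-/
theorem factor_unique (h : IsIsometricImmersionOn g ε f U) {p : M} {v : E5}
    {μ ν : ℝ} (hμ : HasShapeAt g ε f p v μ) (hν : HasShapeAt g ε f p v ν) : μ = ν := by
  have hε0 : ε ≠ 0 := by rcases h.sign with h | h <;> rw [h] <;> norm_num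
  have hv0 : v ≠ 0 := by
    intro h0
    have := hμ.1.1
    rw [h0] at this
    exact hε0 (by rw [← this]; simp [eta])
  by_contra hne
  have h0 : metricAt g p = 0 := by
    ext i j
    have h1 := smul_left_injective ℝ hv0 ((hμ.2 i j).symm.trans (hν.2 i j))
    have h2 := mul_left_cancel₀ hε0 h1
    have h3 : (μ - ν) * metricAt g p i j = 0 := by linear_combination h2
    exact (mul_eq_zero.1 h3).resolve_left (sub_ne_zero.2 hne)
  have h1 := (isLorentzian_coordMetric g (mem_extChartAt_target (I := 𝓡 4) p)).det_neg
  change (metricAt g p).det < 0 at h1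
  rw [h0] at h1
  simp at h1

/-- Near each point an umbilical immersion has a normal field of the form `c - μ f` with constant
`c` and constant umbilical factor `μ`. -/
theorem exists_local_normal (h : IsIsometricImmersionOn g ε f U)
    (hu : ∀ p ∈ U, IsUmbilicalAt g ε f p) {p : M} (hp : p ∈ U) :
    ∃ W : Set M, IsOpen W ∧ p ∈ W ∧ W ⊆ U ∧ ∃ (c : E5) (μ : ℝ),
      ∀ q ∈ W, HasShapeAt g ε f q (c - μ • f q) μ := by
  obtain ⟨ξ, hξ⟩ := h.exists_isUnitNormalFieldOn p
  have hW : IsOpen ((extChartAt (𝓡 4) p).source ∩ U) := (isOpen_extChartAt_source p).inter h.isOpen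
  have h' := h.mono hW Set.inter_subset_right
  -- Umbilicity supplies an unrelated normal at each point. It is `±ξ q`, and the sign moves into
  -- the factor; the value `0` off the chart region is never used.
  have hshape : ∀ q : M, ∃ μ : ℝ, q ∈ (extChartAt (𝓡 4) p).source ∩ U →
      HasShapeAt g ε f q (ξ q) μ := by
    intro q
    by_cases hq : q ∈ (extChartAt (𝓡 4) p).source ∩ U
    · obtain ⟨v, μ, hv⟩ := hu q hq.2
      rcases h.isUnitNormal_eq_or_neg hq.2 (hξ.isUnitNormal q hq) hv.1 with h1 | h1
      · exact ⟨μ, fun _ ↦ h1 ▸ hv⟩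
      · exact ⟨-μ, fun _ ↦ h1 ▸ hv.neg⟩
    · exact ⟨0, fun h ↦ absurd h hq⟩
  choose μ hμ using hshape
  set W := (extChartAt (𝓡 4) p).source ∩ U
  have hpW : p ∈ W := ⟨mem_extChartAt_source p, hp⟩
  obtain ⟨r, hr, hball, hconst⟩ := (h'.localImmersion p).exists_ball_const
    (h'.localNormal hξ p).contDiffOn (μ := fun x ↦ μ ((extChartAt (𝓡 4) p).symm x))
    (fun x hx ↦ (h'.hasShapeAt_iff_of_chart hξ hx _).1 (hμ _ hx.2)) (extChartAt_mem_chartDomain hpW)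
  simp only [coordMap, Function.comp_apply, extChartAt_to_inv] at hconst
  refine ⟨(extChartAt (𝓡 4) p).source ∩ (extChartAt (𝓡 4) p) ⁻¹' Metric.ball (extChartAt (𝓡 4) p p) r,
    isOpen_extChartAt_preimage' p Metric.isOpen_ball,
    ⟨mem_extChartAt_source p, Metric.mem_ball_self hr⟩, fun q hq ↦ ?_, ξ p + μ p • f p, μ p,
    fun q hq ↦ ?_⟩
  · have := (hball hq.2).2
    rw [Set.mem_preimage, (extChartAt (𝓡 4) p).left_inv hq.1] at this
    exact this.2
  · have hqW := (hball hq.2).2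
    have h1 := hconst _ hq.2
    rw [Set.mem_preimage, (extChartAt (𝓡 4) p).left_inv hq.1] at hqW
    rw [(extChartAt (𝓡 4) p).left_inv hq.1] at h1
    rw [← h1.2, add_sub_cancel_right, ← h1.1]
    exact hμ q hqW

/-- An umbilical immersion of a connected set has a normal field of the form `c - μ f` with
constant `c` and constant umbilical factor `μ`. -/
theorem exists_normal_of_umbilical (h : IsIsometricImmersionOn g ε f U)
    (hUc : IsConnected U) (hu : ∀ p ∈ U, IsUmbilicalAt g ε f p) :
    ∃ (c : E5) (μ : ℝ), ∀ q ∈ U, HasShapeAt g ε f q (c - μ • f q) μ := by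
  obtain ⟨p, hp⟩ := hUc.nonempty
  obtain ⟨W, -, hpW, -, c, μ, hcμ⟩ := h.exists_local_normal hu hp
  refine ⟨c, μ, ?_⟩
  set S := {q ∈ U | HasShapeAt g ε f q (c - μ • f q) μ} with hS
  -- A local pair `(d, ν)` whose normal agrees with `c - μ f` at one point of `S` must equal `(c,
  -- μ)`, by uniqueness of the factor. If the normals are opposite, `(-d, -ν)` is used instead. This
  -- makes `S` both open and relatively closed in `U`.
  have hloc : ∀ q ∈ U, ∃ W, IsOpen W ∧ q ∈ W ∧ ((W ∩ S).Nonempty → W ⊆ S) := by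
    intro q hq
    obtain ⟨W, hWo, hqW, hWU, d, ν, hdν⟩ := h.exists_local_normal hu hq
    have hsame : ∀ (d : E5) (ν : ℝ), (∀ q ∈ W, HasShapeAt g ε f q (d - ν • f q) ν) →
        (∃ q ∈ W, q ∈ S ∧ c - μ • f q = d - ν • f q) → W ⊆ S := by
      rintro d ν hdν ⟨q, hqW, hqS, heq⟩ q' hq'
      have h1 := hdν q hqW
      rw [← heq] at h1
      obtain rfl := h.factor_unique hqS.2 h1
      obtain rfl := sub_left_injective heq
      exact ⟨hWU hq', hdν q' hq'⟩
    refine ⟨W, hWo, hqW, ?_⟩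
    rintro ⟨q', hq'W, hq'S⟩
    rcases h.isUnitNormal_eq_or_neg hq'S.1 hq'S.2.1 (hdν q' hq'W).1 with h1 | h1
    · exact hsame d ν hdν ⟨q', hq'W, hq'S, h1⟩
    · have hneg : ∀ y, -d - -ν • f y = -(d - ν • f y) := fun y ↦ by module
      refine hsame (-d) (-ν) (fun y hy ↦ ?_) ⟨q', hq'W, hq'S, ?_⟩
      · rw [hneg]; exact (hdν y hy).neg
      · rw [hneg]; exact h1
  have hSo : IsOpen S := by
    refine isOpen_iff_mem_nhds.2 fun q hq ↦ ?_
    obtain ⟨W, hWo, hqW, hWS⟩ := hloc q hq.1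
    exact Filter.mem_of_superset (hWo.mem_nhds hqW) (hWS ⟨q, hqW, hq⟩)
  have hUS : U ⊆ S := by
    refine hUc.isPreconnected.subset_of_closure_inter_subset hSo ⟨p, hp, hp, hcμ p hpW⟩ ?_
    rintro q ⟨hq, hqU⟩
    obtain ⟨W, hWo, hqW, hWS⟩ := hloc q hqU
    exact hWS (mem_closure_iff.1 hq W hWo hqW) hqW
  exact fun q hq ↦ (hUS hq).2

theorem riemann_eq_of_hasShapeAt (h : IsIsometricImmersionOn g ε f U)
    (hξ : IsUnitNormalFieldOn ε f ξ U) {p : M} (hp : p ∈ U) {μ : ℝ}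
    (hμ : HasShapeAt g ε f p (ξ p) μ) (a b c d : Fin 4) : riemann g p a b c d =
      ε * μ ^ 2 * (metricAt g p a c * metricAt g p d b - metricAt g p a d * metricAt g p c b) := by
  have hx := extChartAt_mem_chartDomain hp
  have h1 := (h.localImmersion p).eta_pd_pd_eq (h.localNormal hξ p) hx
    ((h.hasShapeAt_iff hξ hp μ).1 hμ)
  rw [h.riemann_eq hξ hp, h1, h1, h1, h1, (h.localImmersion p).metric_symm hx b d,
    (h.localImmersion p).metric_symm hx b c]
  simp only [metricAt]
  ring

/-! ### Images in hyperquadrics -/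

/-- A spherical immersion is open onto the hyperquadric that contains it. -/
theorem exists_isOpen_image_eq (h : IsIsometricImmersionOn g ε f U) {s : ℝ} (hs : s ≠ 0)
    (hmem : ∀ p ∈ U, eta ε (f p) (f p) = s)
    (horth : ∀ p ∈ U, ∀ X : TangentSpace (𝓡 4) p, eta ε (differential f p X) (f p) = 0) :
    ∃ W : Set E5, IsOpen W ∧ f '' U = {y | eta ε y y = s} ∩ W := by
  have hnhds : ∀ p ∈ U, {y | eta ε y y = s → y ∈ f '' U} ∈ 𝓝 (f p) := by
    intro p hp
    set F := coordMap f p with hF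
    set x := extChartAt (𝓡 4) p p
    set V := chartDomain U p with hV
    have hx : x ∈ V := extChartAt_mem_chartDomain hp
    have hL := h.localImmersion p
    have hFx : F x = f p := by simp [hF, coordMap, x]
    have hFF : ∀ y ∈ V, eta ε (F y) (F y) = s := fun y hy ↦ hmem _ hy.2
    have hFd : HasStrictFDerivAt F (fderiv ℝ F x) x :=
      (hL.contDiffOn.contDiffAt (hL.isOpen.mem_nhds hx)).hasStrictFDerivAt (by simp)
    have horth' : ∀ v, eta ε (fderiv ℝ F x v) (F x) = 0 := by
      intro v
      rw [fderiv_eq_sum_pd, eta_sum_left]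
      refine Finset.sum_eq_zero fun i _ ↦ ?_
      rw [eta_smul_left, h.pd_coordMap_eq hx]
      have := horth _ hx.2 (frame p x i)
      erw [this]; simp
    -- The derivative at `(x, 1)` of the cone map `(y, t) ↦ t F(y)`. It is injective because `F x`
    -- is orthogonal to the tangent space and `η(F x, F x) = s ≠ 0`; equal dimensions make it
    -- surjective, so the cone covers a neighbourhood of `f p`.
    set Φ' : E4 × ℝ →L[ℝ] E5 := (fderiv ℝ F x).comp (ContinuousLinearMap.fst ℝ E4 ℝ)
      + (ContinuousLinearMap.snd ℝ E4 ℝ).smulRight (F x) with hΦ'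
    have hΦ : HasStrictFDerivAt (fun z : E4 × ℝ ↦ z.2 • F z.1) Φ' (x, 1) := by
      have h1 : HasStrictFDerivAt (fun z : E4 × ℝ ↦ F z.1) _ (x, (1 : ℝ)) :=
        HasStrictFDerivAt.comp (x, (1 : ℝ)) hFd hasStrictFDerivAt_fst
      have h2 := (hasStrictFDerivAt_snd (𝕜 := ℝ) (p := (x, (1 : ℝ)))).fun_smul h1
      rwa [one_smul] at h2
    have hΦ'a : ∀ z, Φ' z = fderiv ℝ F x z.1 + z.2 • F x := fun z ↦ rfl
    have hinj : Function.Injective Φ' := by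
      refine (injective_iff_map_eq_zero Φ').2 fun z hz ↦ ?_
      rw [hΦ'a] at hz
      have h1 : z.2 = 0 := by
        have := congrArg (fun w ↦ eta ε w (F x)) hz
        simp only [eta_add_left, horth', eta_smul_left, hFF x hx] at this
        have h0 : eta ε 0 (F x) = 0 := by simp [eta]
        rw [h0, zero_add] at this
        exact (mul_eq_zero.1 this).resolve_right hs
      rw [h1, zero_smul, add_zero, fderiv_eq_sum_pd] at hz
      have h2 := Fintype.linearIndependent_iff.1 (hL.linearIndependent_pd hx) _ hz
      exact Prod.ext (by ext i; exact h2 i) h1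
    have hsurj : Function.Surjective Φ' :=
      (LinearMap.injective_iff_surjective_of_finrank_eq_finrank (f := Φ'.toLinearMap)
        (by simp)).1 hinj
    have hmap := hΦ.map_nhds_eq_of_surj (LinearMap.range_eq_top.2 hsurj)
    have hmem' : V ×ˢ Set.Ioi (0 : ℝ) ∈ 𝓝 (x, (1 : ℝ)) :=
      prod_mem_nhds (hL.isOpen.mem_nhds hx) (Ioi_mem_nhds one_pos)
    have himg := Filter.image_mem_map (m := fun z : E4 × ℝ ↦ z.2 • F z.1) hmem'
    rw [hmap] at himg
    simp only [one_smul, hFx] at himg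
    refine Filter.mem_of_superset himg ?_
    rintro _ ⟨⟨y, t⟩, ⟨hy, ht⟩, rfl⟩ hys
    simp only [eta_smul_left, eta_smul_right, hFF y hy] at hys
    have ht0 : 0 < t := ht
    -- A cone point on the quadric satisfies `t² s = s`. The restriction `t > 0` excludes `t = -1`,
    -- so the point lies in the image of `f` itself.
    have h1 : (t - 1) * ((t + 1) * s) = 0 := by linear_combination hys
    have h2 : t = 1 := by
      have h3 := (mul_eq_zero.1 h1).resolve_right (mul_ne_zero (by linarith) hs)
      linarith
    exact ⟨_, hy.2, by simp [h2, hF, coordMap]⟩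
  refine ⟨interior {y | eta ε y y = s → y ∈ f '' U}, isOpen_interior, ?_⟩
  ext y
  constructor
  · rintro ⟨p, hp, rfl⟩
    exact ⟨hmem p hp, mem_interior_iff_mem_nhds.2 (hnhds p hp)⟩
  · rintro ⟨hy, hy'⟩
    exact interior_subset hy' hy

end IsIsometricImmersionOn

omit [IsManifold (𝓡 4) ∞ M] in
theorem differential_sub_const {f : M → E5} {p : M}
    (hf : MDifferentiableAt (𝓡 4) 𝓘(ℝ, E5) f p) (a : E5) :
    differential (fun q ↦ f q - a) p = differential f p := by
  have h1 : MDifferentiableAt 𝓘(ℝ, E5) 𝓘(ℝ, E5) (fun y : E5 ↦ y - a) (f p) :=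
    (differentiableAt_id.sub_const a).mdifferentiableAt
  have h2 := mfderiv_comp p h1 hf
  rw [mfderiv_eq_fderiv, fderiv_sub_const, fderiv_fun_id] at h2
  exact h2

/-- An umbilical embedding with nonzero factor is isometric onto an open subset of a
hyperquadric. -/
theorem isIsometricToOpenIn_of_umbilical {g : LorentzMetric M} {ε : ℝ} {f : M → E5} {U : Set M}
    (hε : ε = 1 ∨ ε = -1) (hU : IsOpen U) (hf : IsIsometricEmbeddingOn g ε f U) {c : E5} {μ : ℝ}
    (hμ0 : μ ≠ 0) (hμ : ∀ p ∈ U, IsUnitNormal ε f p (c - μ • f p)) :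
    IsIsometricToOpenIn g ε U {y | eta ε y y = ε / μ ^ 2} := by
  have him : IsIsometricImmersionOn g ε f U := ⟨hε, hU, hf.contMDiffOn, hf.isometric⟩
  -- The centre of the quadric is `c/μ`; moving it to the origin makes the position vector `-μ⁻¹`
  -- times the unit normal.
  set φ : M → E5 := fun q ↦ f q - μ⁻¹ • c with hφ
  have hε0 : ε ≠ 0 := by rcases hε with h | h <;> rw [h] <;> norm_num
  have hdφ : ∀ p ∈ U, differential φ p = differential f p := fun p hp ↦
    differential_sub_const (him.mdifferentiableAt hp) _
  have hφξ : ∀ p, φ p = (-μ⁻¹) • (c - μ • f p) := fun p ↦ by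
    rw [smul_sub, neg_smul, neg_smul, smul_smul, inv_mul_cancel₀ hμ0, one_smul, hφ]
    module
  have hφe : IsIsometricEmbeddingOn g ε φ U := by
    refine ⟨?_, ?_, fun p hp X Y ↦ ?_⟩
    · exact ((contDiff_id.sub contDiff_const).contMDiff
        (f := fun y : E5 ↦ y - μ⁻¹ • c)).comp_contMDiffOn hf.contMDiffOn
    · exact (Homeomorph.subRight (μ⁻¹ • c)).isEmbedding.comp hf.isEmbedding
    · change eta ε (differential φ p X) (differential φ p Y) = _
      rw [hdφ p hp]
      exact hf.isometric p hp X Y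
  refine ⟨φ, hφe, ?_⟩
  refine IsIsometricImmersionOn.exists_isOpen_image_eq
    ⟨hε, hU, hφe.contMDiffOn, hφe.isometric⟩ (div_ne_zero hε0 (pow_ne_zero 2 hμ0))
    (fun p hp ↦ ?_) fun p hp X ↦ ?_
  · rw [hφξ, eta_smul_left, eta_smul_right, (hμ p hp).1]
    field_simp
  · have h1 : eta ε (differential f p X) (c - μ • f p) = 0 := (hμ p hp).2 X
    rw [hdφ p hp, hφξ, eta_smul_right, h1, mul_zero]

/-- An umbilical embedding of a connected open set has a global normal field with constant factor,
constant curvature, and, if the factor is nonzero, an isometric image in a hyperquadric. -/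
theorem umbilical_conclusion {g : LorentzMetric M} {ε : ℝ} (hε : ε = 1 ∨ ε = -1) {f : M → E5}
    {U : Set M} (hU : IsOpen U) (hUc : IsConnected U) (hf : IsIsometricEmbeddingOn g ε f U)
    (hu : ∀ p ∈ U, IsUmbilicalAt g ε f p) :
    ∃ (ξ : M → E5) (μ : ℝ), ContMDiffOn (𝓡 4) 𝓘(ℝ, E5) ∞ ξ U ∧
      (∀ p ∈ U, HasShapeAt g ε f p (ξ p) μ) ∧
      (∀ p ∈ U, ∀ a b c d, riemann g p a b c d = ε * μ ^ 2 *
        (metricAt g p a c * metricAt g p d b - metricAt g p a d * metricAt g p c b)) ∧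
      (μ ≠ 0 → IsIsometricToOpenIn g ε U {y | eta ε y y = ε / μ ^ 2}) := by
  have him : IsIsometricImmersionOn g ε f U := ⟨hε, hU, hf.contMDiffOn, hf.isometric⟩
  obtain ⟨c, μ, hμ⟩ := him.exists_normal_of_umbilical hUc hu
  have hsm : ContMDiffOn (𝓡 4) 𝓘(ℝ, E5) ∞ (fun q ↦ c - μ • f q) U :=
    ((contDiff_const.sub (contDiff_id.const_smul μ)).contMDiff
      (f := fun y : E5 ↦ c - μ • y)).comp_contMDiffOn hf.contMDiffOn
  have hξ : IsUnitNormalFieldOn ε f (fun q ↦ c - μ • f q) U := ⟨hsm, fun p hp ↦ (hμ p hp).1⟩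
  exact ⟨_, μ, hsm, hμ, fun p hp ↦ him.riemann_eq_of_hasShapeAt hξ hp (hμ p hp),
    fun hμ0 ↦ isIsometricToOpenIn_of_umbilical hε hU hf hμ0 hξ.isUnitNormal⟩

end IdealEmbedding

end

/-! ### The main theorem -/

theorem mainTheorem3 {M : Type*} [TopologicalSpace M] [ChartedSpace IdealEmbedding.E4 M]
    [IsManifold (𝓡 4) ∞ M] (g : IdealEmbedding.LorentzMetric M)
    (T : ∀ p : M, TangentSpace (𝓡 4) p) (hT : IdealEmbedding.IsTimelikeField g T)
    (ε : ℝ) (hε : ε = 1 ∨ ε = -1) (f : M → IdealEmbedding.E5)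
    (U : Set M) (hU : IsOpen U) (hUc : IsConnected U)
    (hf : IdealEmbedding.IsIsometricEmbeddingOn g ε f U) :
    ((∀ p ∈ U, IdealEmbedding.IsCausalTypePreservingAt g T ε f p) →
      (∀ p ∈ U, IdealEmbedding.IsIdealZeroAt g ε f p) →
      ∀ p ∈ U, IdealEmbedding.IsUmbilicalAt g ε f p) ∧
    ((∀ p ∈ U, IdealEmbedding.IsUmbilicalAt g ε f p) →
      ∃ (ξ : M → IdealEmbedding.E5) (μ : ℝ),
        ContMDiffOn (𝓡 4) 𝓘(ℝ, IdealEmbedding.E5) ∞ ξ U ∧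
        (∀ p ∈ U, IdealEmbedding.HasShapeAt g ε f p (ξ p) μ) ∧
        (∀ p ∈ U, ∀ a b c d, IdealEmbedding.riemann g p a b c d =
          ε * μ ^ 2 * (IdealEmbedding.metricAt g p a c * IdealEmbedding.metricAt g p d b
            - IdealEmbedding.metricAt g p a d * IdealEmbedding.metricAt g p c b)) ∧
        (μ ≠ 0 → ε = 1 →
          IdealEmbedding.IsIsometricToOpenIn g 1 U (IdealEmbedding.deSitter (1 / |μ|))) ∧
        (μ ≠ 0 → ε = -1 →
          IdealEmbedding.IsIsometricToOpenIn g (-1) U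
            (IdealEmbedding.antiDeSitter (1 / |μ|)))) := by
  refine ⟨fun hc hi p hp ↦ IdealEmbedding.isUmbilicalAt_of_isIdealZeroAt
    ⟨hε, hU, hf.contMDiffOn, hf.isometric⟩ hp (hT.2 p) (hc p hp) (hi p hp), fun hu ↦ ?_⟩
  obtain ⟨ξ, μ, hsm, hshape, hriem, hiso⟩ :=
    IdealEmbedding.umbilical_conclusion hε hU hUc hf hu
  refine ⟨ξ, μ, hsm, hshape, hriem, ?_, ?_⟩
  · rintro hμ rfl
    have h1 : (1 / |μ|) ^ 2 = 1 / μ ^ 2 := by rw [div_pow, one_pow, sq_abs]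
    rw [IdealEmbedding.deSitter, h1]
    exact hiso hμ
  · rintro hμ rfl
    have h1 : -(1 / |μ|) ^ 2 = -1 / μ ^ 2 := by rw [div_pow, one_pow, sq_abs, neg_div]
    rw [IdealEmbedding.antiDeSitter, h1]
    exact hiso hμ
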